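/- **Setting.** Let $m,n\in\mathbb N$ and $r=\min\{m,n\}$. Give $\mathbb R^{m\times n}$ the trace inner product and the Frobenius norm, and let $\sigma(U)\in\mathbb R^r$ be the vector of singular values of $U\in\mathbb R^{m\times n}$ in nonincreasing order. For $z\in\mathbb R^r$ let $\mathrm{dg}(z)\in\mathbb R^{m\times n}$ be the rectangular diagonal matrix with diagonal $z$, and for a matrix $A \in \mathbb R^{m\times n}$ let $\mathrm{Dg}(A)\in\mathbb R^r$ be its diagonal. Let $f_1:\mathbb R^{m\times n}\to\mathbb R$ and $f_2^{\mathcal V}:\mathbb R^r\to\mathbb R$ be continuously differentiable, and let $h^{\mathcal V}:\mathbb R^r\to(-\infty,\infty]$ be proper, lower semicontinuous and convex. Assume that $f_2^{\mathcal V}$ and $h^{\mathcal V}$ are absolutely symmetric (they do not depend on the order or the signs of the entries of their argument). Put $f_2=f_2^{\mathcal V}\circ\sigma$ and $h=h^{\mathcal V}\circ\sigma$. Let $M_2>0$, $\lambda>0$, $\theta>0$ and $Z_0\in\mathbb R^{m\times n}$. Write $\ell_f(u;z)=f(z)+\langle\nabla f(z),u-z\rangle$. **Problems A and B.** Consider data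 $(\mu,M,\psi_s,\psi_n)$ and $(\theta,x_0)$ on a finite-dimensional inner product space $\mathcal Z$, where $\psi_s$ is real-valued and differentiable and $\psi_n$ is proper, lower semicontinuous and convex, and put $\psi=\psi_s+\psi_n$. For $z,u\in\mathrm{dom}\,\psi$ and $v\in\mathcal Z$ let $$\Delta_\mu(u;z,v)=\psi(z)-\psi(u)-\langle v,z-u\rangle+\tfrac{\mu}{2}\|u-z\|^2,$$ and let $z_r=z_r(z,v)$ be the unique minimizer over $u$ of $\langle\nabla\psi_s(z)-v,u\rangle+\frac M2\|u-z\|^2+\psi_n(u)$. Let $(z,v,\varepsilon)\in\mathrm{dom}\,\psi\times\mathcal Z\times\mathbb R_+$. * $(z,v,\varepsilon)$ *solves Problem A* if $v\in\partial_\varepsilon\big(\psi-\frac\mu2\|\cdot-z\|^2\big)(z)$ and $\|v\|^2+2\varepsilon\le\theta^2\|z-x_0\|^2$. Here $w\in\partial_\varepsilon g(z)$ means $g(u)\ge g(z)+\langle w,u-z\rangle-\varepsilon$ for all $u\in\mathcal Z$. * $(z,v,\varepsilon)$ *solves Problem B* if $\|v\|^2+2\varepsilon\le\theta^2\|z-x_0\|^2$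 and $\Delta_\mu(z_r;z,v)\le\varepsilon$. **R-ACG algorithm** (with the same data). Set $y_0=x_0$, $B_0=0$, $\Gamma_0\equiv0$. For $j=1,2,\dots$: 1. Compute $$\xi_{j-1}=\frac{1+\mu B_{j-1}}{M-\mu},\quad b_{j-1}=\frac{\xi_{j-1}+\sqrt{\xi_{j-1}^2+4\xi_{j-1}B_{j-1}}}{2},\quad B_j=B_{j-1}+b_{j-1},$$ $$\tilde x_{j-1}=\frac{B_{j-1}}{B_j}x_{j-1}+\frac{b_{j-1}}{B_j}y_{j-1},\qquad x_j=\operatorname*{argmin}_{u}\Big\{\ell_{\psi_s}(u;\tilde x_{j-1})+\psi_n(u)+\tfrac M2\|u-\tilde x_{j-1}\|^2\Big\},$$ $$y_j=\frac{1}{1+\mu B_j}\big[y_{j-1}-b_{j-1}(M-\mu)(\tilde x_{j-1}-x_j)+\mu(B_{j-1}y_{j-1}+b_{j-1}x_j)\big].$$ 2. Put $$\tilde\gamma_j=\ell_{\psi_s}(\cdot;\tilde x_{j-1})+\psi_n+\tfrac\mu2\|\cdot-\tilde x_{j-1}\|^2,$$ $$\gamma_j=\tilde\gamma_j(x_j)+(M-\mu)\langle\tilde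 x_{j-1}-x_j,\cdot-x_j\rangle+\tfrac\mu2\|\cdot-x_j\|^2,\qquad \Gamma_j=\frac{B_{j-1}}{B_j}\Gamma_{j-1}+\frac{b_{j-1}}{B_j}\gamma_j,$$ $$u_j=\frac{y_0-y_j}{B_j}+\mu(x_j-y_j),\qquad \eta_j=\max\Big\{0,\ \psi(x_j)-\Gamma_j(y_j)-\langle u_j,x_j-y_j\rangle+\tfrac\mu2\|x_j-y_j\|^2\Big\}.$$ 3. If $\frac{1}{1+\mu B_j}\|B_ju_j+x_j-x_0\|^2+2B_j\eta_j\le\|x_j-x_0\|^2$ fails, stop with failure. 4. If $\|u_j\|^2+2\eta_j\le\theta^2\|x_j-x_0\|^2$ fails, go to the next $j$. 5. Otherwise let $(z,v,\varepsilon)=(x_j,u_j,\eta_j)$. If $\Delta_\mu(z_r(z,v);z,v)\le\varepsilon$, stop with success and output $(z,v,\varepsilon)$; if not, stop with failure. **Spectral R-ACG algorithm.** 1. Let $Z_0^\lambda=Z_0-\lambda\nabla f_1(Z_0)$ and compute orthogonal matrices $P\in\mathbb R^{m\times m}$, $Q\in\mathbb R^{n\times n}$ with $Z_0^\lambda=P\,\mathrm{dg}(\sigma(Z_0^\lambda))\,Q^*$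 (one SVD). 2. Call R-ACG on $\mathbb R^r$ with $\mu=1$, $M=\lambda M_2+1$, $\psi_s^{\mathcal V}=\lambda f_2^{\mathcal V}-\langle\sigma(Z_0^\lambda),\cdot\rangle+\frac12\|\cdot\|^2$, $\psi_n^{\mathcal V}=\lambda h^{\mathcal V}$, the given $\theta$, and $x_0=\mathrm{Dg}(P^*Z_0Q)$. If it stops with failure, stop with failure. 3. If it stops with success and output $(y,v,\varepsilon)$, stop with success and output $(Y,V,\varepsilon)=(P\,\mathrm{dg}(y)\,Q^*,\ P\,\mathrm{dg}(v)\,Q^*,\ \varepsilon)$. **Claim.** Consider Problems A and B on $\mathbb R^{m\times n}$ for the matrix prox subproblem, that is, with data $\mu=1$, $M=\lambda M_2+1$, $\psi_s=\lambda[\ell_{f_1}(\cdot;Z_0)+f_2]+\frac12\|\cdot-Z_0\|_F^2$, $\psi_n=\lambda h$, the given $\theta$, and $x_0=Z_0$. (a) If the spectral R-ACG algorithm, run with some SVD of $Z_0^\lambda$, stops with success, then its output $(Y,V,\varepsilon)$ solves Problem B. (b) Suppose that $f_2$ is convex and that $f_2^{\mathcal V}(u)-\ell_{f_2^{\mathcal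 V}}(u;z)\le\frac{M_2}{2}\|u-z\|^2$ for all $u,z\in\mathbb R^r$. Then an SVD of $Z_0^\lambda$ exists and, whichever one is used, the algorithm stops after finitely many iterations, always with success, and its (unique) output $(Y,V,\varepsilon)$ solves Problem A. -/

import Mathlib

noncomputable section

namespace SpectralACG

/-! ## Extended-valued convex functions on a Hilbert space -/

section General

variable {E : Type*} [NormedAddCommGroup E] [InnerProductSpace ℝ E]

/-- `x` is the unique global minimizer of `F`, i.e. `x = argmin F`. -/
def IsArgmin (F : E → EReal) (x : E) : Prop :=
  ∀ u, u ≠ x → F x < F u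

/-- Proper, lower semicontinuous, convex functions with values in `(-∞, ∞]`;
convexity is convexity of the epigraph. -/
structure ProperLscConvex (h : E → EReal) : Prop where
  ne_bot : ∀ u, h u ≠ ⊥
  proper : ∃ u, h u < ⊤
  lsc : LowerSemicontinuous h
  convex : Convex ℝ {p : E × ℝ | h p.1 ≤ (p.2 : EReal)}

/-- The `ε`-subdifferential of `ψ` at `z`. -/
def epsSubdiff (ε : ℝ) (ψ : E → EReal) (z : E) : Set E :=
  {w | ∀ u, ψ z + ((inner ℝ w (u - z) - ε : ℝ) : EReal) ≤ ψ u}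

/-- The linear approximation `ℓ_f(u; z) = f(z) + ⟨∇f(z), u - z⟩`. -/
def linApprox [CompleteSpace E] (f : E → ℝ) (u z : E) : ℝ :=
  f z + inner ℝ (gradient f z) (u - z)

end General

/-! ## Problems A and B, and the relaxed accelerated composite gradient algorithm -/

/-- The input data `(μ, M, ψ_s, ψ_n)` and `(θ, x₀)`. -/
structure Input (E : Type*) where
  μ : ℝ
  M : ℝ
  ψs : E → ℝ
  ψn : E → EReal
  θ : ℝ
  x₀ : E

/-- The ways in which the algorithms can stop. -/
inductive Outcome (E : Type*) where
  | failure : Outcome E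
  | success (z v : E) (ε : ℝ) : Outcome E

/-- Apply a map to the first two components of a successful output. -/
def Outcome.map {E F : Type*} (f : E → F) : Outcome E → Outcome F
  | .failure => .failure
  | .success z v ε => .success (f z) (f v) ε

/-- The quantities `x_j`, `y_j`, `B_j`, `Γ_j` known after iteration `j`. -/
structure State (E : Type*) where
  x : E
  y : E
  B : ℝ
  Γ : E → ℝ

section Algorithm

variable {E : Type*} [NormedAddCommGroup E] [InnerProductSpace ℝ E] [CompleteSpace E]

/-- `ψ = ψ_s + ψ_n`. -/
def Input.ψ (I : Input E) (u : E) : EReal :=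
  (I.ψs u : EReal) + I.ψn u

/-- `Δ_μ(u; z, v)`, for `u` and `z` in the effective domain of `ψ`
(where `ψ` is finite, so that `EReal.toReal` returns its value). -/
def Input.Δ (I : Input E) (u z v : E) : ℝ :=
  (I.ψ z).toReal - (I.ψ u).toReal - inner ℝ v (z - u) + I.μ / 2 * ‖u - z‖ ^ 2

/-- `z_r` is the first component of the refined pair `RP(z, v)`. -/
def Input.IsRefined (I : Input E) (z v zr : E) : Prop :=
  IsArgmin (fun u =>
    ((inner ℝ (gradient I.ψs z - v) u + I.M / 2 * ‖u - z‖ ^ 2 : ℝ) : EReal) + I.ψn u) zr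

/-- `(z, v, ε)` solves Problem A. -/
structure ProblemA (I : Input E) (z v : E) (ε : ℝ) : Prop where
  mem_dom : I.ψ z < ⊤
  eps_nonneg : 0 ≤ ε
  subdiff : v ∈ epsSubdiff ε (fun u => I.ψ u - ((I.μ / 2 * ‖u - z‖ ^ 2 : ℝ) : EReal)) z
  bound : ‖v‖ ^ 2 + 2 * ε ≤ I.θ ^ 2 * ‖z - I.x₀‖ ^ 2

/-- `(z, v, ε)` solves Problem B. -/
structure ProblemB (I : Input E) (z v : E) (ε : ℝ) : Prop where
  mem_dom : I.ψ z < ⊤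
  eps_nonneg : 0 ≤ ε
  bound : ‖v‖ ^ 2 + 2 * ε ≤ I.θ ^ 2 * ‖z - I.x₀‖ ^ 2
  refined : ∃ zr, I.IsRefined z v zr ∧ I.Δ zr z v ≤ ε

/-- Step 0: `x_0 = y_0`, `B_0 = 0`, `Γ_0 = 0`. -/
def Input.init (I : Input E) : State E where
  x := I.x₀
  y := I.x₀
  B := 0
  Γ := fun _ => 0

/-- `ξ_{j-1}`, computed from the state after iteration `j - 1`. -/
def Input.ξ (I : Input E) (s : State E) : ℝ :=
  (1 + I.μ * s.B) / (I.M - I.μ)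

/-- `b_{j-1}`, computed from the state after iteration `j - 1`. -/
def Input.b (I : Input E) (s : State E) : ℝ :=
  (I.ξ s + √(I.ξ s ^ 2 + 4 * I.ξ s * s.B)) / 2

/-- `x̃_{j-1}`, computed from the state after iteration `j - 1`. -/
def Input.xt (I : Input E) (s : State E) : E :=
  (s.B / (s.B + I.b s)) • s.x + (I.b s / (s.B + I.b s)) • s.y

/-- The value `γ̃_j(x)` at a point `x` of the effective domain of `ψ_n`. -/
def Input.γt (I : Input E) (s : State E) (x : E) : ℝ :=
  linApprox I.ψs x (I.xt s) + (I.ψn x).toReal + I.μ / 2 * ‖x - I.xt s‖ ^ 2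

/-- The function `γ_j`, where `x` is `x_j`. -/
def Input.γ (I : Input E) (s : State E) (x : E) (u : E) : ℝ :=
  I.γt s x + (I.M - I.μ) * inner ℝ (I.xt s - x) (u - x) + I.μ / 2 * ‖u - x‖ ^ 2

/-- One iteration leads from the state `s` (index `j - 1`) to the state `t` (index `j`). -/
structure Input.IsStep (I : Input E) (s t : State E) : Prop where
  hB : t.B = s.B + I.b s
  hx : IsArgmin (fun u =>
    ((linApprox I.ψs u (I.xt s) + I.M / 2 * ‖u - I.xt s‖ ^ 2 : ℝ) : EReal) + I.ψn u) t.x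
  hy : t.y = (1 / (1 + I.μ * t.B)) •
    (s.y - (I.b s * (I.M - I.μ)) • (I.xt s - t.x) + I.μ • (s.B • s.y + I.b s • t.x))
  hΓ : ∀ u, t.Γ u = s.B / t.B * s.Γ u + I.b s / t.B * I.γ s t.x u

/-- The residual `u_j = (y_0 - y_j) / B_j + μ (x_j - y_j)`. -/
def Input.res (I : Input E) (t : State E) : E :=
  (1 / t.B) • (I.x₀ - t.y) + I.μ • (t.x - t.y)

/-- The tolerance `η_j`. -/
def Input.η (I : Input E) (t : State E) : ℝ :=
  max 0 ((I.ψ t.x).toReal - t.Γ t.y - inner ℝ (I.res t) (t.x - t.y)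
    + I.μ / 2 * ‖t.x - t.y‖ ^ 2)

/-- The inequality tested in step 3. -/
def Input.Invar (I : Input E) (t : State E) : Prop :=
  1 / (1 + I.μ * t.B) * ‖t.B • I.res t + t.x - I.x₀‖ ^ 2 + 2 * t.B * I.η t
    ≤ ‖t.x - I.x₀‖ ^ 2

/-- The inequality tested in step 4. -/
def Input.Small (I : Input E) (t : State E) : Prop :=
  ‖I.res t‖ ^ 2 + 2 * I.η t ≤ I.θ ^ 2 * ‖t.x - I.x₀‖ ^ 2

/-- `I.Loop s o`: if step 1 is entered in the state `s`, then the algorithm stops after finitely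
many iterations with outcome `o`. -/
inductive Input.Loop (I : Input E) : State E → Outcome E → Prop
  | invar_fails {s t : State E} (step : I.IsStep s t) (invar : ¬ I.Invar t) :
      Input.Loop I s .failure
  | next {s t : State E} {o : Outcome E} (step : I.IsStep s t) (invar : I.Invar t)
      (small : ¬ I.Small t) (rest : Input.Loop I t o) : Input.Loop I s o
  | check_fails {s t : State E} {zr : E} (step : I.IsStep s t) (invar : I.Invar t)
      (small : I.Small t) (refined : I.IsRefined t.x (I.res t) zr)
      (check : ¬ I.Δ zr t.x (I.res t) ≤ I.η t) : Input.Loop I s .failure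
  | check_holds {s t : State E} {zr : E} (step : I.IsStep s t) (invar : I.Invar t)
      (small : I.Small t) (refined : I.IsRefined t.x (I.res t) zr)
      (check : I.Δ zr t.x (I.res t) ≤ I.η t) :
      Input.Loop I s (.success t.x (I.res t) (I.η t))

/-- The R-ACG algorithm with input `I` stops with outcome `o`. -/
def RACG (I : Input E) (o : Outcome E) : Prop :=
  I.Loop I.init o

end Algorithm

/-! ## Matrices and singular values -/

/-- Real `m × n` matrices as a Euclidean space: the norm is the Frobenius norm and the inner
product is the trace inner product. -/
abbrev MatSpace (m n : ℕ) : Type := EuclideanSpace ℝ (Fin m × Fin n)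

/-- `ℝ^r` with `r = min {m, n}`. -/
abbrev VecSpace (m n : ℕ) : Type := EuclideanSpace ℝ (Fin (min m n))

variable {m n : ℕ}

def toMat (U : MatSpace m n) : Matrix (Fin m) (Fin n) ℝ :=
  Matrix.of fun i j => U (i, j)

def ofMat (A : Matrix (Fin m) (Fin n) ℝ) : MatSpace m n :=
  WithLp.toLp 2 fun p => A p.1 p.2

/-- The vector `σ(U)` of the `r = min {m, n}` singular values, in nonincreasing order. -/
def singVals (U : MatSpace m n) : VecSpace m n :=
  WithLp.toLp 2 fun i => (Matrix.toEuclideanLin (toMat U)).singularValues (i : ℕ)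

/-- The rectangular `m × n` diagonal matrix with diagonal `z`. -/
def dg (z : VecSpace m n) : Matrix (Fin m) (Fin n) ℝ :=
  Matrix.of fun i j =>
    if h : (i : ℕ) = (j : ℕ) then z ⟨i, lt_min i.isLt (h ▸ j.isLt)⟩ else 0

/-- The diagonal of an `m × n` matrix. -/
def Dg (A : Matrix (Fin m) (Fin n) ℝ) : VecSpace m n :=
  WithLp.toLp 2 fun i =>
    A (Fin.castLE (min_le_left m n) i) (Fin.castLE (min_le_right m n) i)

/-- The lift `u ↦ P (dg u) Q^*`. -/
def lift (P : Matrix (Fin m) (Fin m) ℝ) (Q : Matrix (Fin n) (Fin n) ℝ)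
    (u : VecSpace m n) : MatSpace m n :=
  ofMat (P * dg u * Q.conjTranspose)

/-- `P`, `Q` are orthogonal and `U = P (dg σ(U)) Q^*`. -/
def IsSVD (P : Matrix (Fin m) (Fin m) ℝ) (Q : Matrix (Fin n) (Fin n) ℝ)
    (U : MatSpace m n) : Prop :=
  P ∈ Matrix.orthogonalGroup (Fin m) ℝ ∧ Q ∈ Matrix.orthogonalGroup (Fin n) ℝ ∧
    U = lift P Q (singVals U)

/-- `f` does not depend on the order or on the signs of the entries of its argument. -/
def AbsSymmetric {α : Type*} {r : ℕ} (f : EuclideanSpace ℝ (Fin r) → α) : Prop :=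
  (∀ (π : Equiv.Perm (Fin r)) (u : EuclideanSpace ℝ (Fin r)),
      f (WithLp.toLp 2 fun i => u (π i)) = f u) ∧
  ∀ u w : EuclideanSpace ℝ (Fin r), (∀ i, |u i| = |w i|) → f u = f w

/-! ## The spectral R-ACG algorithm -/

/-- The matrix `Z_0^λ = Z_0 - λ ∇f_1(Z_0)`. -/
def shifted (f₁ : MatSpace m n → ℝ) (lam : ℝ) (Z₀ : MatSpace m n) : MatSpace m n :=
  Z₀ - lam • gradient f₁ Z₀

/-- The data of the matrix prox subproblem, where `f_2 = f_2^V ∘ σ` and `h = h^V ∘ σ`. -/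
def matInput (M₂ : ℝ) (f₁ : MatSpace m n → ℝ) (f₂V : VecSpace m n → ℝ)
    (hV : VecSpace m n → EReal) (lam θ : ℝ) (Z₀ : MatSpace m n) : Input (MatSpace m n) where
  μ := 1
  M := lam * max M₂ 0 + 1
  ψs := fun U => lam * (linApprox f₁ U Z₀ + f₂V (singVals U)) + 1 / 2 * ‖U - Z₀‖ ^ 2
  ψn := fun U => (lam : EReal) * hV (singVals U)
  θ := θ
  x₀ := Z₀

/-- The data of the vector subproblem built from the decomposition of `Z_0^λ` by `P`, `Q`. -/
def vecInput (M₂ : ℝ) (f₁ : MatSpace m n → ℝ) (f₂V : VecSpace m n → ℝ)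
    (hV : VecSpace m n → EReal) (lam θ : ℝ) (Z₀ : MatSpace m n)
    (P : Matrix (Fin m) (Fin m) ℝ) (Q : Matrix (Fin n) (Fin n) ℝ) : Input (VecSpace m n) where
  μ := 1
  M := lam * max M₂ 0 + 1
  ψs := fun u => lam * f₂V u - inner ℝ (singVals (shifted f₁ lam Z₀)) u + 1 / 2 * ‖u‖ ^ 2
  ψn := fun u => (lam : EReal) * hV u
  θ := θ
  x₀ := Dg (P.conjTranspose * toMat Z₀ * Q)

/-- The spectral R-ACG algorithm, with the pair `(P, Q)` computed in its first step, stops with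
outcome `o`: one singular value decomposition, one vector R-ACG call, and the lift of its output. -/
def SpectralRACG (M₂ : ℝ) (f₁ : MatSpace m n → ℝ) (f₂V : VecSpace m n → ℝ)
    (hV : VecSpace m n → EReal) (lam θ : ℝ) (Z₀ : MatSpace m n)
    (P : Matrix (Fin m) (Fin m) ℝ) (Q : Matrix (Fin n) (Fin n) ℝ)
    (o : Outcome (MatSpace m n)) : Prop :=
  IsSVD P Q (shifted f₁ lam Z₀) ∧
    ∃ o₁, RACG (vecInput M₂ f₁ f₂V hV lam θ Z₀ P Q) o₁ ∧ o = o₁.map (lift P Q)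

end SpectralACG

end

/-! The lift `u ↦ P (dg u) Qᵀ` is a linear isometry from vectors to matrices with adjoint
`diagPart`, and every U is the lift of `diagPart P Q U` plus an orthogonal remainder. Up to a
constant, the matrix ψ is λ f₂(U) + λ h(U) − ⟨Z₀^λ, U⟩ + ½‖U‖². If P, Q come from an SVD of Z₀^λ,
the linear term sees U only through its `diagPart`; an absolutely symmetric function of the singular
values of a lift has the value it takes at the vector. So on lifts the matrix objective is the
vector objective plus a constant. Off the lifts, von Neumann's trace inequality
(`inner_lift_rearr_le`) and a separation argument put `diagPart P Q U` in the convex hull of the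
signed permutations of σ(U), so a convex absolutely symmetric function is no larger at `diagPart P Q
U` than at σ(U).

For (a), the tests passed by a successful vector run are transferred. The refinement objective is
linear plus quadratic plus ψ_n, so only h has to be convex; f₂ enters through its gradient at a
lift, which is the lift of the vector gradient (`AbsSymmetric.hasGradientAt_comp_singVals`). The
error bound survives because the vector starting point is the `diagPart` of Z₀: lifting keeps the
norm of the residual and can only increase the distance to the start.

For (b), convexity passes from f₂ to f₂^V, and the vector data obey quadratic bounds with μ = 1 and
M = λM₂ + 1. The estimate-sequence argument (`Input.Regular.estimate_step`) makes the failure tests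
of steps 3 and 5 pass at every iterate, and B_j grows at least linearly, which eventually forces the
inequality of step 4. Then `problemA_lift` transfers the solution. -/

noncomputable section

set_option linter.unusedSectionVars false

namespace SpectralACG

/-! ### Proximal objectives: existence, uniqueness and quadratic growth of minimizers. -/

section ConvexAnalysis

variable {E : Type*} [NormedAddCommGroup E] [InnerProductSpace ℝ E] {h : E → EReal}

lemma ProperLscConvex.coe_toReal (hh : ProperLscConvex h) {u : E} (hu : h u < ⊤) :
    ((h u).toReal : EReal) = h u :=
  EReal.coe_toReal hu.ne (hh.ne_bot u)

lemma ProperLscConvex.convexOn (hh : ProperLscConvex h) :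
    ConvexOn ℝ {u | h u < ⊤} fun u => (h u).toReal := by
  have key : ∀ x, h x < ⊤ → ∀ y, h y < ⊤ → ∀ a b : ℝ, 0 ≤ a → 0 ≤ b → a + b = 1 →
      h (a • x + b • y) ≤ ((a * (h x).toReal + b * (h y).toReal : ℝ) : EReal) := by
    intro x hx y hy a b ha hb hab
    exact hh.convex (x := (x, (h x).toReal)) (hh.coe_toReal hx).ge
      (y := (y, (h y).toReal)) (hh.coe_toReal hy).ge ha hb hab
  refine ⟨fun x hx y hy a b ha hb hab => ?_, fun x hx y hy a b ha hb hab => ?_⟩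
  · exact (key x hx y hy a b ha hb hab).trans_lt (EReal.coe_lt_top _)
  · have h1 := key x hx y hy a b ha hb hab
    have h2 := EReal.toReal_le_toReal h1 (hh.ne_bot _) (EReal.coe_ne_top _)
    rwa [EReal.toReal_coe] at h2

lemma ProperLscConvex.const_mul (hh : ProperLscConvex h) {c : ℝ} (hc : 0 < c) :
    ProperLscConvex fun u => (c : EReal) * h u := by
  have hc' : (0 : EReal) < c := by exact_mod_cast hc
  refine ⟨fun u => ?_, ?_, ?_, ?_⟩
  · intro hu
    rcases EReal.mul_eq_bot _ _ |>.1 hu with h1 | h1 | h1 | h1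
    · exact EReal.coe_ne_bot _ h1.1
    · exact hh.ne_bot u h1.2
    · exact EReal.coe_ne_top _ h1.1
    · exact absurd h1.1 (not_lt.2 hc'.le)
  · obtain ⟨u, hu⟩ := hh.proper
    refine ⟨u, ?_⟩
    rw [← hh.coe_toReal hu, ← EReal.coe_mul]
    exact EReal.coe_lt_top _
  · have hcont : Continuous fun y : EReal => (c : EReal) * y := by
      refine continuous_iff_continuousAt.2 fun y => ?_
      exact ContinuousAt.comp (f := fun y : EReal => ((c : EReal), y))
        (EReal.continuousAt_mul (Or.inl hc'.ne') (Or.inl hc'.ne') (Or.inl (EReal.coe_ne_bot _))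
          (Or.inl (EReal.coe_ne_top _))) (by fun_prop)
    exact hcont.comp_lowerSemicontinuous hh.lsc (fun a b hab => mul_le_mul_of_nonneg_left hab hc'.le)
  · have hset : {p : E × ℝ | (c : EReal) * h p.1 ≤ (p.2 : EReal)} =
        {p : E × ℝ | h p.1 ≤ ((c⁻¹ * p.2 : ℝ) : EReal)} := by
      ext p
      simp only [Set.mem_ofPred_eq]
      by_cases hp : h p.1 < ⊤
      · rw [← hh.coe_toReal hp, ← EReal.coe_mul, EReal.coe_le_coe_iff, EReal.coe_le_coe_iff,
          inv_mul_eq_div, le_div_iff₀ hc, mul_comm]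
      · rw [not_lt_top_iff] at hp
        rw [hp, EReal.coe_mul_top_of_pos hc]
        simp [-EReal.coe_mul]
    rw [hset]
    exact hh.convex.is_linear_preimage (f := fun p : E × ℝ => (p.1, c⁻¹ * p.2))
      ⟨fun x y => by simp [mul_add], fun a x => by simp [mul_left_comm]⟩

/-- Semicontinuity bounds h below on the unit ball around u₀. A far point u is pulled into that ball
along the segment to u₀, and convexity turns the bound there into one at u that is linear in the
distance. -/
lemma ProperLscConvex.exists_linear_lower_bound [ProperSpace E] (hh : ProperLscConvex h) {u₀ : E}
    (hu₀ : h u₀ < ⊤) : ∃ C, 0 ≤ C ∧ ∀ u, h u < ⊤ → -(C * (1 + ‖u - u₀‖)) ≤ (h u).toReal := by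
  obtain ⟨x, -, hx⟩ := (hh.lsc.lowerSemicontinuousOn _).exists_isMinOn
    (s := Metric.closedBall u₀ 1) ⟨u₀, by simp⟩ (isCompact_closedBall u₀ 1)
  have hx0 : h x < ⊤ := (hx (by simp : u₀ ∈ Metric.closedBall u₀ 1)).trans_lt hu₀
  set m := (h x).toReal with hm
  set p := (h u₀).toReal with hp
  have hball : ∀ u, h u < ⊤ → ‖u - u₀‖ ≤ 1 → m ≤ (h u).toReal := fun u hu hu1 =>
    EReal.toReal_le_toReal (hx (by simpa [dist_eq_norm] using hu1)) (hh.ne_bot _) hu.ne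
  refine ⟨|m| + |p|, by positivity, fun u hu => ?_⟩
  have hm1 := neg_abs_le m
  have hp1 := neg_abs_le p
  have hp2 := le_abs_self p
  have hn := norm_nonneg (u - u₀)
  rcases le_or_gt ‖u - u₀‖ 1 with h1 | h1
  · have := hball u hu h1
    nlinarith [abs_nonneg m, abs_nonneg p]
  · set d := ‖u - u₀‖ with hd
    have hd0 : 0 < d := by linarith
    have hdi : d⁻¹ ≤ 1 := inv_le_one_of_one_le₀ h1.le
    have hc := hh.convexOn
    have hmem := hc.1 hu₀ hu (sub_nonneg.2 hdi) (inv_nonneg.2 hn) (by ring)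
    have hle := hc.2 hu₀ hu (sub_nonneg.2 hdi) (inv_nonneg.2 hn) (by ring)
    have hb := hball _ hmem (by
      have : (1 - d⁻¹) • u₀ + d⁻¹ • u - u₀ = d⁻¹ • (u - u₀) := by module
      rw [this, norm_smul, Real.norm_of_nonneg (inv_nonneg.2 hn), ← hd, inv_mul_cancel₀ hd0.ne'])
    have h2 := hb.trans hle
    simp only [smul_eq_mul] at h2
    have h3 := mul_le_mul_of_nonneg_left h2 hn
    have h4 : d * ((1 - d⁻¹) * p + d⁻¹ * (h u).toReal) = d * p - p + (h u).toReal := by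
      field_simp
    rw [h4] at h3
    nlinarith [abs_nonneg m, abs_nonneg p]

/-- A proximal objective: a quadratic function of modulus `M` plus `h`. -/
def proxObj (h : E → EReal) (a : ℝ) (g z : E) (M : ℝ) (u : E) : EReal :=
  ((a + inner ℝ g u + M / 2 * ‖u - z‖ ^ 2 : ℝ) : EReal) + h u

lemma ProperLscConvex.proxObj_of_lt_top (hh : ProperLscConvex h) {a : ℝ} {g z : E} {M : ℝ} {u : E}
    (hu : h u < ⊤) : proxObj h a g z M u =
      ((a + inner ℝ g u + M / 2 * ‖u - z‖ ^ 2 + (h u).toReal : ℝ) : EReal) := by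
  rw [proxObj, ← hh.coe_toReal hu, EReal.coe_add]
  simp

lemma proxObj_lt_top_iff {a : ℝ} {g z : E} {M : ℝ}
    {u : E} : proxObj h a g z M u < ⊤ ↔ h u < ⊤ := by
  rw [proxObj]
  constructor
  · intro h1
    by_contra h2
    rw [not_lt_top_iff] at h2
    rw [h2, EReal.coe_add_top] at h1
    exact lt_irrefl _ h1
  · intro h1
    exact EReal.add_lt_top (EReal.coe_ne_top _) h1.ne

lemma norm_segment_sub_sq (x u z : E) (t : ℝ) :
    ‖(1 - t) • x + t • u - z‖ ^ 2 =
      (1 - t) * ‖x - z‖ ^ 2 + t * ‖u - z‖ ^ 2 - t * (1 - t) * ‖u - x‖ ^ 2 := by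
  have h1 : (1 - t) • x + t • u - z = (1 - t) • (x - z) + t • (u - z) := by module
  have h2 : u - x = (u - z) - (x - z) := by abel
  rw [h1, h2]
  generalize x - z = p
  generalize u - z = q
  simp only [← real_inner_self_eq_norm_sq, inner_add_left, inner_add_right, inner_sub_left,
    inner_sub_right, real_inner_smul_left, real_inner_smul_right, real_inner_comm p q]
  ring

lemma ProperLscConvex.lt_top_of_isMin (hh : ProperLscConvex h) {a : ℝ} {g z x : E} {M : ℝ}
    (hx : ∀ u, proxObj h a g z M x ≤ proxObj h a g z M u) : h x < ⊤ := by
  obtain ⟨u, hu⟩ := hh.proper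
  exact proxObj_lt_top_iff.1 ((hx u).trans_lt (proxObj_lt_top_iff.2 hu))

/-- Quadratic growth of a strongly convex proximal objective at its minimizer. -/
lemma ProperLscConvex.quadratic_growth (hh : ProperLscConvex h) {a : ℝ} {g z x : E} {M : ℝ}
    (hx : ∀ u, proxObj h a g z M x ≤ proxObj h a g z M u) {u : E} (hu : h u < ⊤) :
    a + inner ℝ g x + M / 2 * ‖x - z‖ ^ 2 + (h x).toReal + M / 2 * ‖u - x‖ ^ 2 ≤
      a + inner ℝ g u + M / 2 * ‖u - z‖ ^ 2 + (h u).toReal := by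
  have hxd := hh.lt_top_of_isMin hx
  -- Minimality is tested at the point (1 - t)x + tu; division by t leaves the claim with a factor 1
  -- - t, removed by t → 0.
  have main : ∀ t : ℝ, 0 < t → t < 1 →
      a + inner ℝ g x + M / 2 * ‖x - z‖ ^ 2 + (h x).toReal + (1 - t) * (M / 2 * ‖u - x‖ ^ 2) ≤
      a + inner ℝ g u + M / 2 * ‖u - z‖ ^ 2 + (h u).toReal := by
    intro t ht0 ht1
    have hmem := hh.convexOn.1 hxd hu (sub_nonneg.2 ht1.le) ht0.le (by ring)
    have hle := hh.convexOn.2 hxd hu (sub_nonneg.2 ht1.le) ht0.le (by ring)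
    have h1 := hx ((1 - t) • x + t • u)
    rw [hh.proxObj_of_lt_top hxd, hh.proxObj_of_lt_top hmem, EReal.coe_le_coe_iff,
      norm_segment_sub_sq] at h1
    simp only [inner_add_right, real_inner_smul_right, smul_eq_mul] at h1 hle
    have h2 : 0 ≤ t * (a + inner ℝ g u + M / 2 * ‖u - z‖ ^ 2 + (h u).toReal -
      (a + inner ℝ g x + M / 2 * ‖x - z‖ ^ 2 + (h x).toReal
        + (1 - t) * (M / 2 * ‖u - x‖ ^ 2))) := by
      linarith
    have := nonneg_of_mul_nonneg_right h2 ht0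
    linarith
  have hlim : Filter.Tendsto (fun t : ℝ => a + inner ℝ g x + M / 2 * ‖x - z‖ ^ 2 + (h x).toReal
      + (1 - t) * (M / 2 * ‖u - x‖ ^ 2)) (nhdsWithin 0 (Set.Ioi 0))
      (nhds (a + inner ℝ g x + M / 2 * ‖x - z‖ ^ 2 + (h x).toReal
        + (1 - 0) * (M / 2 * ‖u - x‖ ^ 2))) :=
    (Continuous.tendsto (by fun_prop) 0).mono_left nhdsWithin_le_nhds
  have := le_of_tendsto hlim (by
    filter_upwards [Ioo_mem_nhdsGT (zero_lt_one' ℝ)] with t ht using main t ht.1 ht.2)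
  linarith

lemma ProperLscConvex.isArgmin_of_isMin (hh : ProperLscConvex h) {a : ℝ} {g z x : E} {M : ℝ}
    (hM : 0 < M) (hx : ∀ u, proxObj h a g z M x ≤ proxObj h a g z M u) :
    IsArgmin (proxObj h a g z M) x := by
  intro u hux
  have hxd := hh.lt_top_of_isMin hx
  by_cases hu : h u < ⊤
  · have := hh.quadratic_growth hx hu
    have hpos : 0 < ‖u - x‖ := norm_pos_iff.2 (sub_ne_zero.2 hux)
    rw [hh.proxObj_of_lt_top hxd, hh.proxObj_of_lt_top hu, EReal.coe_lt_coe_iff]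
    have : 0 < M / 2 * ‖u - x‖ ^ 2 := by positivity
    linarith
  · have h1 : proxObj h a g z M x < ⊤ := proxObj_lt_top_iff.2 hxd
    have h2 : proxObj h a g z M u = ⊤ := by
      rw [← not_lt_top_iff]
      exact fun h3 => hu (proxObj_lt_top_iff.1 h3)
    rwa [h2]

lemma IsArgmin.le {α : Type*} {F : α → EReal} {x : α} (hx : IsArgmin F x) (u : α) : F x ≤ F u := by
  rcases eq_or_ne u x with rfl | hu
  · exact le_rfl
  · exact (hx u hu).le

lemma IsArgmin.eq {α : Type*} {F : α → EReal} {x y : α} (hx : IsArgmin F x) (hy : IsArgmin F y) : x = y := by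
  by_contra hne
  exact lt_asymm (hx y (Ne.symm hne)) (hy x hne)

/-- Coercivity: h falls at most linearly while the quadratic term grows, so outside a compact ball
the objective exceeds its value at u₀. -/
lemma ProperLscConvex.exists_isArgmin [ProperSpace E] (hh : ProperLscConvex h) (a : ℝ) (g z : E)
    {M : ℝ} (hM : 0 < M) : ∃ x, IsArgmin (proxObj h a g z M) x := by
  obtain ⟨u₀, hu₀⟩ := hh.proper
  obtain ⟨C, hC, hlow⟩ := hh.exists_linear_lower_bound hu₀
  have hlsc : LowerSemicontinuous (proxObj h a g z M) := by
    refine LowerSemicontinuous.add' ?_ hh.lsc fun u => EReal.continuousAt_add ?_ ?_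
    · exact (continuous_coe_real_ereal.comp (by fun_prop)).lowerSemicontinuous
    · exact Or.inl (EReal.coe_ne_top _)
    · exact Or.inl (EReal.coe_ne_bot _)
  set v₀ := a + inner ℝ g u₀ + M / 2 * ‖u₀ - z‖ ^ 2 + (h u₀).toReal with hv₀
  set β := ‖g‖ + C with hβ
  set γ := v₀ - a - inner ℝ g z + C * (1 + ‖z - u₀‖) with hγ
  -- Beyond R, s = ‖u - z‖ satisfies M/2 · s > β + |γ| and s ≥ 1, so M/2 · s² beats the lower-order
  -- terms βs + γ.
  set R := max ‖u₀ - z‖ ((β + |γ|) * 2 / M + 1) with hR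
  have hfar : ∀ u, R < ‖u - z‖ → proxObj h a g z M u₀ < proxObj h a g z M u := by
    intro u hu
    by_cases hud : h u < ⊤
    · rw [hh.proxObj_of_lt_top hu₀, hh.proxObj_of_lt_top hud, EReal.coe_lt_coe_iff]
      have h1 := hlow u hud
      have h2 : ‖u - u₀‖ ≤ ‖u - z‖ + ‖z - u₀‖ := norm_sub_le_norm_sub_add_norm_sub u z u₀
      have h3 : inner ℝ g u = inner ℝ g z + inner ℝ g (u - z) := by
        rw [inner_sub_right]; ring
      have h4 : -(‖g‖ * ‖u - z‖) ≤ inner ℝ g (u - z) :=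
        (abs_le.1 (abs_real_inner_le_norm g (u - z))).1
      have h5 : (β + |γ|) * 2 / M + 1 < ‖u - z‖ := (le_max_right _ _).trans_lt hu
      set s := ‖u - z‖ with hs
      have hβ0 : 0 ≤ β := by positivity
      have h6 : 1 ≤ s := by
        have : 0 ≤ (β + |γ|) * 2 / M := by positivity
        linarith
      have h7 : β + |γ| < M / 2 * s := by
        have h8 : (β + |γ|) * 2 / M < s := by linarith
        rw [div_lt_iff₀ hM] at h8
        linarith
      have h9 := le_abs_self γ
      have h10 : C * ‖u - u₀‖ ≤ C * (s + ‖z - u₀‖) := mul_le_mul_of_nonneg_left h2 hC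
      have h11 : (β + |γ|) * s < M / 2 * s * s := mul_lt_mul_of_pos_right h7 (by linarith)
      have h12 : |γ| ≤ |γ| * s := le_mul_of_one_le_right (abs_nonneg _) h6
      rw [h3]
      nlinarith
    · have h2 : proxObj h a g z M u = ⊤ := by
        rw [← not_lt_top_iff]
        exact fun h3 => hud (proxObj_lt_top_iff.1 h3)
      rw [h2]
      exact proxObj_lt_top_iff.2 hu₀
  have hu₀mem : u₀ ∈ Metric.closedBall z R := by
    simp [dist_eq_norm, hR]
  obtain ⟨x, -, hx⟩ := (hlsc.lowerSemicontinuousOn _).exists_isMinOn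
    (s := Metric.closedBall z R) ⟨u₀, hu₀mem⟩ (isCompact_closedBall z R)
  refine ⟨x, hh.isArgmin_of_isMin hM fun u => ?_⟩
  rcases le_or_gt ‖u - z‖ R with h1 | h1
  · exact hx (by simpa [dist_eq_norm] using h1)
  · exact (hx hu₀mem).trans (hfar u h1).le

end ConvexAnalysis

/-! ### The algorithm is deterministic. -/

section Determinism

variable {E : Type*} [NormedAddCommGroup E] [InnerProductSpace ℝ E] [CompleteSpace E] {I : Input E}

lemma Input.IsStep.eq {s t t' : State E} (ht : I.IsStep s t) (ht' : I.IsStep s t') : t = t' := by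
  obtain ⟨x, y, B, Γ⟩ := t
  obtain ⟨x', y', B', Γ'⟩ := t'
  have hB : B = B' := ht.hB.trans ht'.hB.symm
  have hx : x = x' := ht.hx.eq ht'.hx
  have hy : y = y' := by
    have h1 := ht.hy
    have h2 := ht'.hy
    simp only at h1 h2
    rw [h1, h2, hB, hx]
  have hΓ : Γ = Γ' := by
    funext u
    have h1 := ht.hΓ u
    have h2 := ht'.hΓ u
    simp only at h1 h2
    rw [h1, h2, hB, hx]
  rw [hB, hx, hy, hΓ]

/-- `IsArgmin` includes uniqueness, so steps and refined points are determined by the state and two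
runs cannot branch differently. -/
lemma Input.Loop.eq {s : State E} {o o' : Outcome E} (h : I.Loop s o) (h' : I.Loop s o') :
    o = o' := by
  induction h generalizing o' with
  | invar_fails step invar =>
    cases h' with
    | invar_fails => rfl
    | next step' invar' => exact absurd (step.eq step' ▸ invar') invar
    | check_fails step' invar' => exact absurd (step.eq step' ▸ invar') invar
    | check_holds step' invar' => exact absurd (step.eq step' ▸ invar') invar
  | next step invar small rest ih =>
    cases h' with
    | invar_fails step' invar' => exact absurd (step.eq step' ▸ invar) invar'
    | next step' _ _ rest' => exact ih (step.eq step' ▸ rest')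
    | check_fails step' _ small' => exact absurd (step.eq step' ▸ small') small
    | check_holds step' _ small' => exact absurd (step.eq step' ▸ small') small
  | check_fails step invar small refined check =>
    cases h' with
    | invar_fails => rfl
    | next step' _ small' => exact absurd (step.eq step' ▸ small) small'
    | check_fails => rfl
    | check_holds step' _ _ refined' check' =>
      obtain rfl := step.eq step'
      obtain rfl := IsArgmin.eq refined refined'
      exact absurd check' check
  | check_holds step invar small refined check =>
    cases h' with
    | invar_fails step' invar' => exact absurd (step.eq step' ▸ invar) invar'
    | next step' _ small' => exact absurd (step.eq step' ▸ small) small'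
    | check_fails step' _ _ refined' check' =>
      obtain rfl := step.eq step'
      obtain rfl := IsArgmin.eq refined refined'
      exact absurd check check'
    | check_holds step' _ _ refined' check' =>
      obtain rfl := step.eq step'
      rfl

/-- Every success of the loop comes from an iterate that passes all the tests. -/
lemma Input.Loop.exists_of_success {s : State E} {z v : E} {ε : ℝ}
    (h : I.Loop s (.success z v ε)) : ∃ s t zr, I.IsStep s t ∧ I.Small t ∧
      I.IsRefined t.x (I.res t) zr ∧ I.Δ zr t.x (I.res t) ≤ I.η t ∧
      z = t.x ∧ v = I.res t ∧ ε = I.η t := by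
  generalize ho : Outcome.success z v ε = o at h
  induction h with
  | invar_fails => cases ho
  | next _ _ _ _ ih => exact ih ho
  | check_fails => cases ho
  | check_holds step _ small refined check =>
    cases ho
    exact ⟨_, _, _, step, small, refined, check, rfl, rfl, rfl⟩

end Determinism

/-! ### Estimate sequences and termination of R-ACG on regular data. -/

section Convergence

variable {E : Type*} [NormedAddCommGroup E] [InnerProductSpace ℝ E] [CompleteSpace E]

/-- The smooth part lies between its `μ`-lower and `M`-upper quadratic models. -/
structure Input.Regular (I : Input E) : Prop where
  μ_nonneg : 0 ≤ I.μ
  μ_lt : I.μ < I.M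
  θ_pos : 0 < I.θ
  lower : ∀ u z, linApprox I.ψs u z + I.μ / 2 * ‖u - z‖ ^ 2 ≤ I.ψs u
  upper : ∀ u z, I.ψs u ≤ linApprox I.ψs u z + I.M / 2 * ‖u - z‖ ^ 2
  ψn : ProperLscConvex I.ψn

/-- The real value of `ψ` on its domain. -/
def Input.val (I : Input E) (u : E) : ℝ := I.ψs u + (I.ψn u).toReal

lemma Input.ψ_eq {I : Input E} {u : E} (hbot : I.ψn u ≠ ⊥) (hu : I.ψn u < ⊤) :
    I.ψ u = (I.val u : EReal) := by
  rw [Input.ψ, Input.val, EReal.coe_add, EReal.coe_toReal hu.ne hbot]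

lemma Input.ψ_lt_top_iff {I : Input E} {u : E} : I.ψ u < ⊤ ↔ I.ψn u < ⊤ := by
  rw [Input.ψ]
  constructor
  · intro h1
    by_contra h2
    rw [not_lt_top_iff] at h2
    rw [h2, EReal.coe_add_top] at h1
    exact lt_irrefl _ h1
  · intro h1
    exact EReal.add_lt_top (EReal.coe_ne_top _) h1.ne

lemma Input.step_objective (I : Input E) (s : State E) :
    (fun u => ((linApprox I.ψs u (I.xt s) + I.M / 2 * ‖u - I.xt s‖ ^ 2 : ℝ) : EReal) + I.ψn u) =
      proxObj I.ψn (I.ψs (I.xt s) - inner ℝ (gradient I.ψs (I.xt s)) (I.xt s))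
        (gradient I.ψs (I.xt s)) (I.xt s) I.M := by
  funext u
  rw [proxObj, linApprox, inner_sub_right]
  congr 3
  ring

lemma Input.refined_objective (I : Input E) (z v : E) :
    (fun u => ((inner ℝ (gradient I.ψs z - v) u + I.M / 2 * ‖u - z‖ ^ 2 : ℝ) : EReal)
      + I.ψn u) = proxObj I.ψn 0 (gradient I.ψs z - v) z I.M := by
  funext u
  rw [proxObj, zero_add]

lemma Input.IsStep.lt_top {I : Input E} (hψn : ProperLscConvex I.ψn) {s t : State E}
    (ht : I.IsStep s t) : I.ψn t.x < ⊤ := by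
  have hx := ht.hx
  rw [I.step_objective] at hx
  exact hψn.lt_top_of_isMin hx.le

variable [ProperSpace E] {I : Input E}

lemma Input.Regular.exists_isStep (hI : I.Regular) (s : State E) : ∃ t, I.IsStep s t := by
  have hM : 0 < I.M := hI.μ_nonneg.trans_lt hI.μ_lt
  obtain ⟨x, hx⟩ := hI.ψn.exists_isArgmin
    (I.ψs (I.xt s) - inner ℝ (gradient I.ψs (I.xt s)) (I.xt s)) (gradient I.ψs (I.xt s)) (I.xt s) hM
  rw [← I.step_objective] at hx
  exact ⟨⟨x, (1 / (1 + I.μ * (s.B + I.b s))) •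
    (s.y - (I.b s * (I.M - I.μ)) • (I.xt s - x) + I.μ • (s.B • s.y + I.b s • x)), s.B + I.b s,
    fun u => s.B / (s.B + I.b s) * s.Γ u + I.b s / (s.B + I.b s) * I.γ s x u⟩,
    rfl, hx, rfl, fun u => rfl⟩

lemma Input.Regular.exists_isRefined (hI : I.Regular) (z v : E) : ∃ zr, I.IsRefined z v zr := by
  have hM : 0 < I.M := hI.μ_nonneg.trans_lt hI.μ_lt
  obtain ⟨x, hx⟩ := hI.ψn.exists_isArgmin 0 (gradient I.ψs z - v) z hM
  rw [← I.refined_objective] at hx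
  exact ⟨x, hx⟩

lemma Input.Regular.ξ_pos (hI : I.Regular) {s : State E} (hs : 0 ≤ s.B) : 0 < I.ξ s := by
  have h1 := hI.μ_lt
  have h2 := mul_nonneg hI.μ_nonneg hs
  exact div_pos (by linarith) (by linarith)

/-- This makes B_j grow at least linearly, which is all that finite termination needs. -/
lemma Input.Regular.le_b (hI : I.Regular) {s : State E} (hs : 0 ≤ s.B) :
    1 / (I.M - I.μ) ≤ I.b s := by
  have h0 := hI.ξ_pos hs
  have h1 : 1 / (I.M - I.μ) ≤ I.ξ s := by
    rw [Input.ξ]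
    have := sub_pos.2 hI.μ_lt
    have h2 := mul_nonneg hI.μ_nonneg hs
    gcongr
    linarith
  have h2 : I.ξ s ≤ √(I.ξ s ^ 2 + 4 * I.ξ s * s.B) := by
    apply Real.le_sqrt_of_sq_le
    have := mul_nonneg h0.le hs
    linarith
  rw [Input.b]
  linarith

lemma Input.Regular.b_pos (hI : I.Regular) {s : State E} (hs : 0 ≤ s.B) : 0 < I.b s :=
  (one_div_pos.2 (sub_pos.2 hI.μ_lt)).trans_le (hI.le_b hs)

/-- The step length b is the positive root of this quadratic equation; the identity lets the square
be completed in `estimate_step`. -/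
lemma Input.Regular.b_sq (hI : I.Regular) {s : State E} (hs : 0 ≤ s.B) :
    (I.M - I.μ) * I.b s ^ 2 = (1 + I.μ * s.B) * (s.B + I.b s) := by
  have h0 := hI.ξ_pos hs
  have hM := sub_pos.2 hI.μ_lt
  have h1 : (I.M - I.μ) * I.ξ s = 1 + I.μ * s.B := by
    rw [Input.ξ]
    field_simp
  have h2 : √(I.ξ s ^ 2 + 4 * I.ξ s * s.B) ^ 2 = I.ξ s ^ 2 + 4 * I.ξ s * s.B :=
    Real.sq_sqrt (by have := mul_nonneg h0.le hs; positivity)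
  have h3 : I.b s ^ 2 = I.ξ s * (s.B + I.b s) := by
    rw [Input.b]
    linear_combination h2 / 4
  rw [h3, ← h1]
  ring

/-- The estimate-sequence invariants of the accelerated method. -/
structure Input.Estimate (I : Input E) (s : State E) : Prop where
  B_nonneg : 0 ≤ s.B
  minorant : ∀ u, I.ψn u < ⊤ → s.B * s.Γ u ≤ s.B * I.val u
  quad : ∀ u, s.B * s.Γ u + 1 / 2 * ‖u - I.x₀‖ ^ 2 =
    s.B * s.Γ s.y + 1 / 2 * ‖s.y - I.x₀‖ ^ 2 + (1 + I.μ * s.B) / 2 * ‖u - s.y‖ ^ 2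
  mem : 0 < s.B → I.ψn s.x < ⊤
  value : s.B * I.val s.x ≤ s.B * s.Γ s.y + 1 / 2 * ‖s.y - I.x₀‖ ^ 2

lemma Input.estimate_init (I : Input E) : I.Estimate I.init := by
  constructor <;> simp [Input.init]

/-- Quadratic growth of the prox subproblem at x_j, minus (M - μ)/2 · ‖u - x̃‖² expanded around x_j,
puts γ_j below γ̃_j; the lower model of ψ_s puts γ̃_j below ψ. -/
lemma Input.Regular.γ_le (hI : I.Regular) {s t : State E} (ht : I.IsStep s t) {u : E}
    (hu : I.ψn u < ⊤) : I.γ s t.x u ≤ I.val u := by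
  have hx := ht.hx
  rw [I.step_objective] at hx
  have h1 := hI.ψn.quadratic_growth hx.le hu
  have h2 := hI.lower u (I.xt s)
  rw [Input.γ, Input.γt, Input.val]
  rw [linApprox] at h2 ⊢
  generalize I.xt s = z at h1 h2 ⊢
  rw [inner_sub_right] at h2 ⊢
  have h3 : ‖u - z‖ ^ 2 = ‖t.x - z‖ ^ 2 + ‖u - t.x‖ ^ 2 - 2 * inner ℝ (z - t.x) (u - t.x) := by
    have : u - z = (u - t.x) - (z - t.x) := by abel
    rw [this, norm_sub_sq_real, norm_sub_rev z, real_inner_comm]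
    ring
  rw [h3] at h1 h2
  nlinarith

lemma norm_sub_sq_shift {y y' u : E} :
    ‖u - y‖ ^ 2 = ‖y' - y‖ ^ 2 + 2 * inner ℝ (y' - y) (u - y') + ‖u - y'‖ ^ 2 := by
  have : u - y = (y' - y) + (u - y') := by abel
  rw [this, norm_add_sq_real]

/-- `minorant` averages minorants of ψ, `quad` says that y_j minimizes B_jΓ_j + ½‖· - x₀‖², and
`value` is where the upper model of ψ_s and the choice of b are spent. -/
lemma Input.Regular.estimate_step (hI : I.Regular) {s t : State E} (hs : I.Estimate s)
    (ht : I.IsStep s t) : I.Estimate t := by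
  have hB := hs.B_nonneg
  have hb := hI.b_pos hB
  have hBt : 0 < t.B := by rw [ht.hB]; linarith
  have hμ := hI.μ_nonneg
  have hMμ : 0 < I.M - I.μ := sub_pos.2 hI.μ_lt
  have hxd := ht.lt_top hI.ψn
  have hΓ : ∀ u, t.B * t.Γ u = s.B * s.Γ u + I.b s * I.γ s t.x u := by
    intro u
    rw [ht.hΓ u]
    field_simp
  have hmin : ∀ u, I.ψn u < ⊤ → t.B * t.Γ u ≤ t.B * I.val u := by
    intro u hu
    have h1 := hs.minorant u hu
    have h2 := mul_le_mul_of_nonneg_left (hI.γ_le ht hu) hb.le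
    rw [hΓ, ht.hB]
    linarith
  have hquad : ∀ u, t.B * t.Γ u + 1 / 2 * ‖u - I.x₀‖ ^ 2 =
      t.B * t.Γ t.y + 1 / 2 * ‖t.y - I.x₀‖ ^ 2 + (1 + I.μ * t.B) / 2 * ‖u - t.y‖ ^ 2 := by
    intro u
    have h1 := hs.quad u
    have h2 := hs.quad t.y
    have hpos : 1 + I.μ * t.B ≠ 0 := by positivity
    have hy : (1 + I.μ * t.B) • t.y =
        s.y - (I.b s * (I.M - I.μ)) • (I.xt s - t.x) + I.μ • (s.B • s.y + I.b s • t.x) := by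
      rw [ht.hy, smul_smul, mul_one_div_cancel hpos, one_smul]
    -- The y-update read as stationarity at t.y of (1 + μB)/2 · ‖· - s.y‖² + bγ.
    have hzero : (1 + I.μ * s.B) • (t.y - s.y) + (I.b s * (I.M - I.μ)) • (I.xt s - t.x)
        + (I.b s * I.μ) • (t.y - t.x) = 0 := by
      have : (1 + I.μ * s.B) • (t.y - s.y) + (I.b s * (I.M - I.μ)) • (I.xt s - t.x)
          + (I.b s * I.μ) • (t.y - t.x) = (1 + I.μ * (s.B + I.b s)) • t.y -
          (s.y - (I.b s * (I.M - I.μ)) • (I.xt s - t.x) + I.μ • (s.B • s.y + I.b s • t.x)) := by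
        module
      rw [this, ← ht.hB, hy, sub_self]
    have hinner := congrArg (fun w => inner ℝ w (u - t.y)) hzero
    simp only [inner_add_left, real_inner_smul_left, inner_zero_left] at hinner
    have h3 : inner ℝ (I.xt s - t.x) (u - t.x) =
        inner ℝ (I.xt s - t.x) (u - t.y) + inner ℝ (I.xt s - t.x) (t.y - t.x) := by
      rw [← inner_add_right]
      congr 1
      abel
    have h4 := norm_sub_sq_shift (y := s.y) (y' := t.y) (u := u)
    have h5 := norm_sub_sq_shift (y := t.x) (y' := t.y) (u := u)
    rw [hΓ, hΓ, Input.γ, Input.γ, ht.hB, h3, h5]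
    rw [h4] at h1
    linear_combination h1 - h2 + hinner
  refine ⟨hBt.le, hmin, hquad, fun _ => hxd, ?_⟩
  have h1 := hs.quad t.y
  have h2 := hs.value
  have h3 : s.B * I.γ s t.x s.x ≤ s.B * I.val s.x := by
    rcases hB.eq_or_lt with h0 | h0
    · rw [← h0]; simp
    · exact mul_le_mul_of_nonneg_left (hI.γ_le ht (hs.mem h0)) hB
  have hxt : t.B • I.xt s = s.B • s.x + I.b s • s.y := by
    rw [Input.xt, ← ht.hB, smul_add, smul_smul, smul_smul, mul_div_cancel₀ _ hBt.ne',
      mul_div_cancel₀ _ hBt.ne']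
  -- γ is evaluated at s.x and t.y with weights s.B and b; the definition of x̃ rewrites their
  -- weighted displacement in terms of x̃ - t.x and t.y - s.y.
  have hvec : s.B • (s.x - t.x) + I.b s • (t.y - t.x) =
      t.B • (I.xt s - t.x) + I.b s • (t.y - s.y) := by
    rw [smul_sub t.B, hxt, ht.hB]
    module
  have hinner := congrArg (fun w => inner ℝ (I.xt s - t.x) w) hvec
  simp only [inner_add_right, real_inner_smul_right, real_inner_self_eq_norm_sq] at hinner
  have hval : I.val t.x ≤ I.γt s t.x + (I.M - I.μ) / 2 * ‖I.xt s - t.x‖ ^ 2 := by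
    have := hI.upper t.x (I.xt s)
    rw [Input.val, Input.γt, norm_sub_rev (I.xt s)]
    linarith
  have hval' := mul_le_mul_of_nonneg_left hval hBt.le
  -- After `b_sq`, division by t.B gives ‖t.y - s.y‖² the coefficient (1 + μB)/2, exactly what
  -- `quad` for the previous state supplies.
  have hsq : 0 ≤ (I.M - I.μ) / 2 * ‖t.B • (I.xt s - t.x) + I.b s • (t.y - s.y)‖ ^ 2 := by
    positivity
  rw [norm_add_sq_real, norm_smul, norm_smul, mul_pow, mul_pow, real_inner_smul_left,
    real_inner_smul_right, Real.norm_eq_abs, Real.norm_eq_abs, sq_abs, sq_abs] at hsq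
  have hbsq := hI.b_sq hB
  rw [← ht.hB] at hbsq
  have hsq' : 0 ≤ t.B * ((I.M - I.μ) / 2 * (t.B * ‖I.xt s - t.x‖ ^ 2
      + 2 * I.b s * inner ℝ (I.xt s - t.x) (t.y - s.y))
      + (1 + I.μ * s.B) / 2 * ‖t.y - s.y‖ ^ 2) := by
    linear_combination hsq + ‖t.y - s.y‖ ^ 2 / 2 * hbsq
  have hsq'' := nonneg_of_mul_nonneg_right hsq' hBt
  have hn1 : 0 ≤ s.B * (I.μ / 2 * ‖s.x - t.x‖ ^ 2) := by positivity
  have hn2 : 0 ≤ I.b s * (I.μ / 2 * ‖t.y - t.x‖ ^ 2) := by positivity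
  rw [hΓ]
  have hγ : s.B * I.γ s t.x s.x + I.b s * I.γ s t.x t.y = t.B * I.γt s t.x + (I.M - I.μ) *
      (t.B * ‖I.xt s - t.x‖ ^ 2 + I.b s * inner ℝ (I.xt s - t.x) (t.y - s.y))
      + s.B * (I.μ / 2 * ‖s.x - t.x‖ ^ 2) + I.b s * (I.μ / 2 * ‖t.y - t.x‖ ^ 2) := by
    rw [Input.γ, Input.γ, ht.hB] at *
    linear_combination (I.M - I.μ) * hinner
  linarith

/-- The gap that defines the tolerance `η`. -/
def Input.gap (I : Input E) (t : State E) : ℝ :=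
  I.val t.x - t.Γ t.y - inner ℝ (I.res t) (t.x - t.y) + I.μ / 2 * ‖t.x - t.y‖ ^ 2

/-- The minorant Γ is an explicit quadratic by `quad`. Expanding it around t.x produces the slope
`res`, and the loss at t.x is `gap`. -/
lemma Input.Estimate.subgradient {t : State E} (ht : I.Estimate t) (hB : 0 < t.B) {u : E}
    (hu : I.ψn u < ⊤) :
    I.val t.x + inner ℝ (I.res t) (u - t.x) - I.gap t + I.μ / 2 * ‖u - t.x‖ ^ 2 ≤ I.val u := by
  have h1 := ht.minorant u hu
  have h2 := ht.quad u
  have h3 := norm_sub_sq_shift (y := I.x₀) (y' := t.y) (u := u)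
  have h4 := norm_sub_sq_shift (y := t.y) (y' := t.x) (u := u)
  have h5 : inner ℝ (t.y - I.x₀) (u - t.y) =
      inner ℝ (t.y - I.x₀) (u - t.x) + inner ℝ (t.y - I.x₀) (t.x - t.y) := by
    rw [← inner_add_right]; congr 1; abel
  have hres : t.B • I.res t = (I.μ * t.B) • (t.x - t.y) - (t.y - I.x₀) := by
    rw [Input.res, smul_add, smul_smul, mul_one_div_cancel hB.ne']
    module
  have h6 := congrArg (fun w => inner ℝ w (u - t.x)) hres
  have h7 := congrArg (fun w => inner ℝ w (t.x - t.y)) hres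
  simp only [inner_sub_left, real_inner_smul_left] at h6 h7
  simp only [← inner_sub_left (𝕜 := ℝ)] at h6 h7
  rw [real_inner_self_eq_norm_sq] at h7
  have : t.B * (I.val t.x + inner ℝ (I.res t) (u - t.x) - I.gap t + I.μ / 2 * ‖u - t.x‖ ^ 2) ≤
      t.B * I.val u := by
    rw [Input.gap]
    rw [h3, h5] at h2
    rw [h4] at h2
    linarith
  exact le_of_mul_le_mul_left this hB

/-- The subgradient inequality at u = t.x says that the gap is nonnegative, so the maximum with 0 is
inactive. -/
lemma Input.Estimate.η_eq_gap (hI : I.Regular) {t : State E} (ht : I.Estimate t) (hB : 0 < t.B) :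
    I.η t = I.gap t := by
  have h1 := ht.subgradient hB (ht.mem hB)
  rw [sub_self, inner_zero_right, norm_zero] at h1
  have h2 : 0 ≤ I.gap t := by linarith
  rw [Input.η, I.ψ_eq (hI.ψn.ne_bot _) (ht.mem hB), EReal.toReal_coe]
  exact max_eq_right h2

/-- The vector inside the norm is (1 + μB)(x - y); after expanding ‖x - x₀‖² around y, the test is a
rewriting of `value`. -/
lemma Input.Estimate.invar (hI : I.Regular) {t : State E} (ht : I.Estimate t) (hB : 0 < t.B) :
    I.Invar t := by
  have hμ := hI.μ_nonneg
  have hpos : 0 < 1 + I.μ * t.B := by positivity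
  have hres : t.B • I.res t = (I.μ * t.B) • (t.x - t.y) - (t.y - I.x₀) := by
    rw [Input.res, smul_add, smul_smul, mul_one_div_cancel hB.ne']
    module
  have h1 : t.B • I.res t + t.x - I.x₀ = (1 + I.μ * t.B) • (t.x - t.y) := by
    rw [hres]
    module
  have h7 := congrArg (fun w => inner ℝ w (t.x - t.y)) hres
  simp only [inner_sub_left, real_inner_smul_left] at h7
  simp only [← inner_sub_left (𝕜 := ℝ)] at h7
  rw [real_inner_self_eq_norm_sq] at h7
  have h8 : 1 / (1 + I.μ * t.B) * ((1 + I.μ * t.B) ^ 2 * ‖t.x - t.y‖ ^ 2) =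
      (1 + I.μ * t.B) * ‖t.x - t.y‖ ^ 2 := by
    field_simp
  rw [Input.Invar, h1, ht.η_eq_gap hI hB, Input.gap, norm_smul, mul_pow, Real.norm_eq_abs, sq_abs,
    h8, norm_sub_sq_shift (y := I.x₀) (y' := t.y) (u := t.x)]
  have := ht.value
  linarith

/-- With N = ‖x - x₀‖, the invariant gives B²‖res‖² ≤ (4 + 2μB)N² and 2Bη ≤ N². For B ≥ 1 this
yields B²(‖res‖² + 2η) ≤ (5 + 2μ)BN². -/
lemma Input.Estimate.small (hI : I.Regular) {t : State E} (ht : I.Estimate t) (h1 : 1 ≤ t.B)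
    (h2 : (5 + 2 * I.μ) / I.θ ^ 2 ≤ t.B) : I.Small t := by
  have hμ := hI.μ_nonneg
  have hB : 0 < t.B := by linarith
  have hinv := ht.invar hI hB
  rw [Input.Invar] at hinv
  have hη : 0 ≤ I.η t := le_max_left _ _
  set N := ‖t.x - I.x₀‖ with hN
  have hpos : 0 < 1 + I.μ * t.B := by positivity
  have h3 : ‖t.B • I.res t + t.x - I.x₀‖ ^ 2 ≤ (1 + I.μ * t.B) * N ^ 2 := by
    have h4 : 1 / (1 + I.μ * t.B) * ‖t.B • I.res t + t.x - I.x₀‖ ^ 2 ≤ N ^ 2 := by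
      have : 0 ≤ 2 * t.B * I.η t := by positivity
      linarith
    rwa [one_div, inv_mul_le_iff₀ hpos] at h4
  have h4 : 2 * t.B * I.η t ≤ N ^ 2 := by
    have : 0 ≤ 1 / (1 + I.μ * t.B) * ‖t.B • I.res t + t.x - I.x₀‖ ^ 2 := by positivity
    linarith
  have h5 : t.B ^ 2 * ‖I.res t‖ ^ 2 ≤ 2 * ‖t.B • I.res t + t.x - I.x₀‖ ^ 2 + 2 * N ^ 2 := by
    have h6 : t.B • I.res t = (t.B • I.res t + t.x - I.x₀) - (t.x - I.x₀) := by abel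
    have h7 : ‖t.B • I.res t‖ ^ 2 = t.B ^ 2 * ‖I.res t‖ ^ 2 := by
      rw [norm_smul, mul_pow, Real.norm_eq_abs, sq_abs]
    rw [← h7]
    have h8 := norm_sub_le (t.B • I.res t + t.x - I.x₀) (t.x - I.x₀)
    rw [← h6, ← hN] at h8
    nlinarith [norm_nonneg (t.B • I.res t),
      sq_nonneg (‖t.B • I.res t + t.x - I.x₀‖ - N)]
  have hθ : 0 < I.θ ^ 2 := pow_pos hI.θ_pos 2
  rw [div_le_iff₀ hθ] at h2
  rw [Input.Small]
  have h9 : t.B ^ 2 * (‖I.res t‖ ^ 2 + 2 * I.η t) ≤ t.B ^ 2 * (I.θ ^ 2 * N ^ 2) := by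
    have h10 : t.B * (2 * t.B * I.η t) ≤ t.B * N ^ 2 := mul_le_mul_of_nonneg_left h4 hB.le
    have h11 : (5 + 2 * I.μ) * (t.B * N ^ 2) ≤ t.B * I.θ ^ 2 * (t.B * N ^ 2) :=
      mul_le_mul_of_nonneg_right h2 (by positivity)
    have h12 : N ^ 2 ≤ t.B * N ^ 2 := le_mul_of_one_le_left (sq_nonneg _) h1
    nlinarith
  exact le_of_mul_le_mul_left h9 (by positivity)

/-- The subgradient inequality bounds Δ at every point of the domain, in particular at the refined
point. -/
lemma Input.Estimate.check (hI : I.Regular) {t : State E} (ht : I.Estimate t) (hB : 0 < t.B)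
    {u : E} (hu : I.ψn u < ⊤) : I.Δ u t.x (I.res t) ≤ I.η t := by
  have h1 := ht.subgradient hB hu
  rw [ht.η_eq_gap hI hB, Input.Δ, I.ψ_eq (hI.ψn.ne_bot _) hu, I.ψ_eq (hI.ψn.ne_bot _) (ht.mem hB), EReal.toReal_coe,
    EReal.toReal_coe, ← neg_sub u t.x, inner_neg_right]
  linarith

lemma Input.Estimate.problemA (hI : I.Regular) {t : State E} (ht : I.Estimate t) (hB : 0 < t.B)
    (hsmall : I.Small t) : ProblemA I t.x (I.res t) (I.η t) := by
  refine ⟨Input.ψ_lt_top_iff.2 (ht.mem hB), le_max_left _ _, fun u => ?_, hsmall⟩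
  by_cases hu : I.ψn u < ⊤
  · have h1 := ht.subgradient hB hu
    simp only [I.ψ_eq (hI.ψn.ne_bot _) hu, I.ψ_eq (hI.ψn.ne_bot _) (ht.mem hB)]
    norm_cast
    rw [sub_self, norm_zero, ht.η_eq_gap hI hB]
    linarith
  · have : I.ψ u = ⊤ := by
      rw [← not_lt_top_iff]
      exact fun h3 => hu (Input.ψ_lt_top_iff.1 h3)
    simp only [this, EReal.top_sub_coe, le_top]

/-- N + 1 further steps suffice to carry B past the threshold K, where `small` applies; the loop may
stop earlier. -/
lemma Input.Regular.exists_loop (hI : I.Regular) {K : ℝ} (hK1 : 1 ≤ K)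
    (hK2 : (5 + 2 * I.μ) / I.θ ^ 2 ≤ K) (N : ℕ) (s : State E) (hs : I.Estimate s)
    (hN : K ≤ s.B + (N + 1) * (1 / (I.M - I.μ))) :
    ∃ z v ε, I.Loop s (.success z v ε) ∧ ProblemA I z v ε := by
  induction N generalizing s with
  | zero =>
    obtain ⟨t, ht⟩ := hI.exists_isStep s
    have hte := hI.estimate_step hs ht
    have hb := hI.le_b hs.B_nonneg
    have hBK : K ≤ t.B := by
      rw [ht.hB]
      simp only [Nat.cast_zero] at hN
      linarith
    have hB : 0 < t.B := by linarith
    have hsmall := hte.small hI (hK1.trans hBK) (hK2.trans hBK)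
    obtain ⟨zr, hzr⟩ := hI.exists_isRefined t.x (I.res t)
    have hzd : I.ψn zr < ⊤ := by
      have := hzr
      rw [Input.IsRefined, I.refined_objective] at this
      exact hI.ψn.lt_top_of_isMin this.le
    exact ⟨_, _, _, .check_holds ht (hte.invar hI hB) hsmall hzr (hte.check hI hB hzd),
      hte.problemA hI hB hsmall⟩
  | succ N ih =>
    obtain ⟨t, ht⟩ := hI.exists_isStep s
    have hte := hI.estimate_step hs ht
    have hb := hI.le_b hs.B_nonneg
    have hB : 0 < t.B := by
      rw [ht.hB]
      linarith [hs.B_nonneg, hI.b_pos hs.B_nonneg]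
    by_cases hsmall : I.Small t
    · obtain ⟨zr, hzr⟩ := hI.exists_isRefined t.x (I.res t)
      have hzd : I.ψn zr < ⊤ := by
        have := hzr
        rw [Input.IsRefined, I.refined_objective] at this
        exact hI.ψn.lt_top_of_isMin this.le
      exact ⟨_, _, _, .check_holds ht (hte.invar hI hB) hsmall hzr (hte.check hI hB hzd),
        hte.problemA hI hB hsmall⟩
    · obtain ⟨z, v, ε, hl, hA⟩ := ih t hte (by
        rw [ht.hB]
        push_cast at hN
        linarith)
      exact ⟨z, v, ε, .next ht (hte.invar hI hB) hsmall hl, hA⟩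

/-- On regular data the algorithm stops, with success, at a solution of Problem A. -/
theorem Input.Regular.racg (hI : I.Regular) :
    ∃ z v ε, (∀ o, RACG I o ↔ o = .success z v ε) ∧ ProblemA I z v ε := by
  have hpos : 0 < 1 / (I.M - I.μ) := one_div_pos.2 (sub_pos.2 hI.μ_lt)
  set K := max 1 ((5 + 2 * I.μ) / I.θ ^ 2) with hK
  obtain ⟨N, hN⟩ := exists_nat_ge (K / (1 / (I.M - I.μ)))
  rw [div_le_iff₀ hpos] at hN
  obtain ⟨z, v, ε, hl, hA⟩ := hI.exists_loop (le_max_left _ _) (le_max_right _ _) N I.init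
    I.estimate_init (by
      rw [show I.init.B = 0 from rfl]
      linarith)
  exact ⟨z, v, ε, fun o => ⟨fun ho => Input.Loop.eq ho hl, fun ho => ho ▸ hl⟩, hA⟩

end Convergence

/-! ### Signed permutations and a rearrangement inequality. -/

section Rearrangement

variable {r : ℕ}

lemma intUnit_mul_self (e : ℤˣ) : ((e : ℤ) : ℝ) * ((e : ℤ) : ℝ) = 1 := by
  rcases Int.units_eq_one_or e with h | h <;> simp [h]

lemma intUnit_abs (e : ℤˣ) : |((e : ℤ) : ℝ)| = 1 := by
  rcases Int.units_eq_one_or e with h | h <;> simp [h]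

/-- The signed permutation `x ↦ (s_i x_{π i})_i`. -/
def rearr (π : Equiv.Perm (Fin r)) (s : Fin r → ℤˣ) :
    EuclideanSpace ℝ (Fin r) ≃ₗᵢ[ℝ] EuclideanSpace ℝ (Fin r) where
  toFun x := WithLp.toLp 2 fun i => ((s i : ℤ) : ℝ) * x (π i)
  invFun x := WithLp.toLp 2 fun i => ((s (π.symm i) : ℤ) : ℝ) * x (π.symm i)
  map_add' x y := by ext i; simp [mul_add]
  map_smul' a x := by ext i; simp [mul_left_comm]
  left_inv x := by ext i; simp [← mul_assoc, intUnit_mul_self]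
  right_inv x := by ext i; simp [← mul_assoc, intUnit_mul_self]
  norm_map' x := by
    rw [EuclideanSpace.norm_eq, EuclideanSpace.norm_eq]
    congr 1
    simp only [LinearEquiv.coe_mk, LinearMap.coe_mk, AddHom.coe_mk, Real.norm_eq_abs, abs_mul,
      intUnit_abs, one_mul]
    exact Equiv.sum_comp π fun i => |x i| ^ 2

@[simp] lemma rearr_apply (π : Equiv.Perm (Fin r)) (s : Fin r → ℤˣ)
    (x : EuclideanSpace ℝ (Fin r)) (i : Fin r) : rearr π s x i = ((s i : ℤ) : ℝ) * x (π i) := rfl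

/-- Nonnegative vectors with nonincreasing entries. -/
def Sorted (x : EuclideanSpace ℝ (Fin r)) : Prop :=
  (∀ i j, i ≤ j → x j ≤ x i) ∧ ∀ i, 0 ≤ x i

lemma AbsSymmetric.rearr {α : Type*} {f : EuclideanSpace ℝ (Fin r) → α} (hf : AbsSymmetric f)
    (π : Equiv.Perm (Fin r)) (s : Fin r → ℤˣ) (x : EuclideanSpace ℝ (Fin r)) :
    f (rearr π s x) = f x := by
  rw [← hf.1 π x]
  apply hf.2
  intro i
  simp [abs_mul, intUnit_abs]

lemma exists_eq_rearr (x : EuclideanSpace ℝ (Fin r)) :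
    ∃ π s, ∃ x' : EuclideanSpace ℝ (Fin r), Sorted x' ∧ x = rearr π s x' := by
  set σ := Tuple.sort fun i => -|x i| with hσ
  refine ⟨σ.symm, fun i => if 0 ≤ x i then 1 else -1, WithLp.toLp 2 fun k => |x (σ k)|,
    ⟨fun i j hij => ?_, fun i => by simp⟩, ?_⟩
  · have := Tuple.monotone_sort (fun i => -|x i|) hij
    simp only [Function.comp_apply, neg_le_neg_iff] at this
    exact this
  · ext i
    simp only [rearr_apply, Equiv.apply_symm_apply]
    split_ifs with h
    · simp [abs_of_nonneg h]
    · simp [abs_of_neg (not_le.1 h)]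

/-- Abel summation: the weights are x_k - x_{k+1}, where x is extended by 0 past its last index. -/
lemma exists_layer_cake {x : Fin r → ℝ} (hx : ∀ i j, i ≤ j → x j ≤ x i) (hx0 : ∀ i, 0 ≤ x i) :
    ∃ α : Fin r → ℝ, (∀ k, 0 ≤ α k) ∧ ∀ i, x i = ∑ k, if i ≤ k then α k else 0 := by
  set X : ℕ → ℝ := fun k => if h : k < r then x ⟨k, h⟩ else 0 with hX
  refine ⟨fun k => X k - X (k + 1), fun k => ?_, fun i => ?_⟩
  · simp only [hX, k.isLt, dif_pos, sub_nonneg]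
    split_ifs with h
    · exact hx _ _ (by simp [Fin.le_def])
    · exact hx0 _
  · have key : ∀ N, (i : ℕ) ≤ N →
        ∑ k ∈ Finset.range N, (if (i : ℕ) ≤ k then X k - X (k + 1) else 0) = X i - X N := by
      intro N hN
      induction N, hN using Nat.le_induction with
      | base =>
        rw [sub_self]
        exact Finset.sum_eq_zero fun k hk => if_neg (not_le.2 (Finset.mem_range.1 hk))
      | succ N hN ih =>
        rw [Finset.sum_range_succ, ih, if_pos hN]
        ring
    have h1 := key r i.isLt.le
    rw [Finset.sum_range] at h1
    simp only [Fin.le_def]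
    rw [h1]
    simp [hX]

/-- Both sides are bilinear, so layer cakes reduce the claim to indicators of two initial segments.
There the left side is a block sum of c, bounded by the shorter segment through row or column sums.
-/
lemma sum_mul_le_of_substochastic {c : Fin r → Fin r → ℝ} (hc : ∀ i j, 0 ≤ c i j)
    (hrow : ∀ i, ∑ j, c i j ≤ 1) (hcol : ∀ j, ∑ i, c i j ≤ 1) {x y : Fin r → ℝ}
    (hx : ∀ i j, i ≤ j → x j ≤ x i) (hx0 : ∀ i, 0 ≤ x i)
    (hy : ∀ i j, i ≤ j → y j ≤ y i) (hy0 : ∀ i, 0 ≤ y i) :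
    ∑ i, ∑ j, c i j * (x i * y j) ≤ ∑ i, x i * y i := by
  obtain ⟨α, hα, hxα⟩ := exists_layer_cake hx hx0
  obtain ⟨β, hβ, hyβ⟩ := exists_layer_cake hy hy0
  have hprod : ∀ i j, x i * y j =
      ∑ k, ∑ l, α k * β l * ((if i ≤ k then 1 else 0) * (if j ≤ l then 1 else 0)) := by
    intro i j
    rw [hxα, hyβ, Finset.sum_mul_sum]
    refine Finset.sum_congr rfl fun k _ => Finset.sum_congr rfl fun l _ => ?_
    split_ifs <;> simp
  have h1 : ∑ i, ∑ j, c i j * (x i * y j) = ∑ k, ∑ l, α k * β l *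
      ∑ i, ∑ j, c i j * ((if i ≤ k then 1 else 0) * (if j ≤ l then 1 else 0)) := by
    simp only [hprod, Finset.mul_sum]
    rw [Finset.sum_congr rfl fun i _ => Finset.sum_comm, Finset.sum_comm]
    refine Finset.sum_congr rfl fun k _ => ?_
    rw [Finset.sum_congr rfl fun i _ => Finset.sum_comm, Finset.sum_comm]
    refine Finset.sum_congr rfl fun l _ => Finset.sum_congr rfl fun i _ =>
      Finset.sum_congr rfl fun j _ => ?_
    ring
  have h2 : ∑ i, x i * y i = ∑ k, ∑ l, α k * β l *
      ∑ i, ((if i ≤ k then 1 else 0) * (if i ≤ l then 1 else 0)) := by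
    simp only [hprod, Finset.mul_sum]
    rw [Finset.sum_comm]
    refine Finset.sum_congr rfl fun k _ => ?_
    rw [Finset.sum_comm]
  rw [h1, h2]
  refine Finset.sum_le_sum fun k _ => Finset.sum_le_sum fun l _ =>
    mul_le_mul_of_nonneg_left ?_ (mul_nonneg (hα k) (hβ l))
  rcases le_total k l with hkl | hkl
  · refine Finset.sum_le_sum fun i _ => ?_
    by_cases hi : i ≤ k
    · simp only [hi, hi.trans hkl, if_true, one_mul]
      refine le_trans (Finset.sum_le_sum fun j _ => ?_) (hrow i)
      split_ifs <;> simp [hc]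
    · simp [hi]
  · rw [Finset.sum_comm]
    refine Finset.sum_le_sum fun i _ => ?_
    by_cases hi : i ≤ l
    · simp only [hi, hi.trans hkl, if_true, mul_one]
      refine le_trans (Finset.sum_le_sum fun j _ => ?_) (hcol i)
      split_ifs <;> simp [hc]
    · simp [hi]

end Rearrangement

/-! ### The lift, its adjoint, and the resulting orthogonal splitting. -/

section Matrices

variable {m n : ℕ}

/-- Row and column positions of the diagonal. -/
abbrev rowIdx (i : Fin (min m n)) : Fin m := Fin.castLE (min_le_left m n) i

abbrev colIdx (i : Fin (min m n)) : Fin n := Fin.castLE (min_le_right m n) i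

lemma dg_apply_rowIdx_colIdx (w : VecSpace m n) (i : Fin (min m n)) :
    dg w (rowIdx i) (colIdx i) = w i := by
  simp [dg]

lemma dg_eq_sum (w : VecSpace m n) (a : Fin m) (b : Fin n) :
    dg w a b = ∑ i, if a = rowIdx i ∧ b = colIdx i then w i else 0 := by
  rw [dg, Matrix.of_apply]
  split_ifs with h
  · rw [Finset.sum_eq_single_of_mem (⟨a, lt_min a.isLt (h ▸ b.isLt)⟩ : Fin (min m n))
      (Finset.mem_univ _)]
    · rw [if_pos]
      exact ⟨Fin.ext rfl, Fin.ext h.symm⟩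
    · intro i _ hi
      rw [if_neg]
      rintro ⟨h1, -⟩
      exact hi (Fin.ext (by simp [h1]))
  · refine (Finset.sum_eq_zero fun i _ => if_neg ?_).symm
    rintro ⟨h1, h2⟩
    exact h (by simp [h1, h2])

lemma lift_apply (P : Matrix (Fin m) (Fin m) ℝ) (Q : Matrix (Fin n) (Fin n) ℝ)
    (w : VecSpace m n) (a : Fin m) (b : Fin n) :
    lift P Q w (a, b) = ∑ i, P a (rowIdx i) * w i * Q b (colIdx i) := by
  simp only [lift, ofMat, Matrix.mul_apply, Matrix.conjTranspose_apply, star_trivial, dg_eq_sum,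
    Finset.mul_sum, Finset.sum_mul]
  rw [Finset.sum_congr rfl fun j _ => Finset.sum_comm, Finset.sum_comm]
  refine Finset.sum_congr rfl fun i _ => ?_
  rw [Finset.sum_eq_single_of_mem (colIdx i) (Finset.mem_univ _),
    Finset.sum_eq_single_of_mem (rowIdx i) (Finset.mem_univ _)]
  · simp
  · intro k _ hk
    simp [hk]
  · intro j _ hj
    simp [hj]

/-- The diagonal of `P^* U Q`. -/
def diagPart (P : Matrix (Fin m) (Fin m) ℝ) (Q : Matrix (Fin n) (Fin n) ℝ)
    (U : MatSpace m n) : VecSpace m n :=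
  Dg (P.conjTranspose * toMat U * Q)

lemma diagPart_apply (P : Matrix (Fin m) (Fin m) ℝ) (Q : Matrix (Fin n) (Fin n) ℝ)
    (U : MatSpace m n) (i : Fin (min m n)) :
    diagPart P Q U i = ∑ a, ∑ b, P a (rowIdx i) * U (a, b) * Q b (colIdx i) := by
  simp only [diagPart, Dg, Matrix.mul_apply, Matrix.conjTranspose_apply, star_trivial, toMat,
    Matrix.of_apply, Finset.sum_mul]
  rw [Finset.sum_comm]

/-- `diagPart` is the adjoint of `lift`; orthogonality of P and Q is not needed for this. -/
lemma inner_lift (P : Matrix (Fin m) (Fin m) ℝ) (Q : Matrix (Fin n) (Fin n) ℝ)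
    (w : VecSpace m n) (U : MatSpace m n) :
    inner ℝ (lift P Q w) U = inner ℝ w (diagPart P Q U) := by
  simp only [PiLp.inner_apply, RCLike.inner_apply, conj_trivial, Fintype.sum_prod_type, lift_apply,
    diagPart_apply, Finset.sum_mul, Finset.mul_sum]
  rw [Finset.sum_congr rfl fun a _ => Finset.sum_comm, Finset.sum_comm]
  refine Finset.sum_congr rfl fun i _ => Finset.sum_congr rfl fun a _ =>
    Finset.sum_congr rfl fun b _ => ?_
  ring

lemma lift_add (P : Matrix (Fin m) (Fin m) ℝ) (Q : Matrix (Fin n) (Fin n) ℝ)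
    (u v : VecSpace m n) : lift P Q (u + v) = lift P Q u + lift P Q v := by
  ext ⟨a, b⟩
  simp [lift_apply, mul_add, add_mul, Finset.sum_add_distrib]

lemma lift_smul (P : Matrix (Fin m) (Fin m) ℝ) (Q : Matrix (Fin n) (Fin n) ℝ)
    (c : ℝ) (u : VecSpace m n) : lift P Q (c • u) = c • lift P Q u := by
  ext ⟨a, b⟩
  simp only [lift_apply, PiLp.smul_apply, smul_eq_mul, Finset.mul_sum]
  exact Finset.sum_congr rfl fun i _ => by ring

lemma lift_sub (P : Matrix (Fin m) (Fin m) ℝ) (Q : Matrix (Fin n) (Fin n) ℝ)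
    (u v : VecSpace m n) : lift P Q (u - v) = lift P Q u - lift P Q v := by
  rw [sub_eq_add_neg, sub_eq_add_neg, ← neg_one_smul ℝ v, lift_add, lift_smul, neg_one_smul]

variable {P : Matrix (Fin m) (Fin m) ℝ} {Q : Matrix (Fin n) (Fin n) ℝ}

lemma toMat_lift (w : VecSpace m n) : toMat (lift P Q w) = P * dg w * Q.conjTranspose := rfl

lemma conjTranspose_mul_self {k : ℕ} {P : Matrix (Fin k) (Fin k) ℝ}
    (hP : P ∈ Matrix.orthogonalGroup (Fin k) ℝ) : P.conjTranspose * P = 1 := by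
  rw [Matrix.conjTranspose_eq_transpose_of_trivial]
  exact (Matrix.mem_orthogonalGroup_iff' _ _).1 hP

lemma mul_conjTranspose_self {k : ℕ} {P : Matrix (Fin k) (Fin k) ℝ}
    (hP : P ∈ Matrix.orthogonalGroup (Fin k) ℝ) : P * P.conjTranspose = 1 := by
  rw [Matrix.conjTranspose_eq_transpose_of_trivial]
  exact (Matrix.mem_orthogonalGroup_iff _ _).1 hP

lemma diagPart_lift (hP : P ∈ Matrix.orthogonalGroup (Fin m) ℝ)
    (hQ : Q ∈ Matrix.orthogonalGroup (Fin n) ℝ) (w : VecSpace m n) :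
    diagPart P Q (lift P Q w) = w := by
  have h : P.conjTranspose * toMat (lift P Q w) * Q = dg w := by
    rw [toMat_lift, ← Matrix.mul_assoc, ← Matrix.mul_assoc, conjTranspose_mul_self hP,
      Matrix.one_mul, Matrix.mul_assoc, conjTranspose_mul_self hQ, Matrix.mul_one]
  rw [diagPart, h]
  ext i
  exact dg_apply_rowIdx_colIdx w i

lemma inner_lift_lift (hP : P ∈ Matrix.orthogonalGroup (Fin m) ℝ)
    (hQ : Q ∈ Matrix.orthogonalGroup (Fin n) ℝ) (u v : VecSpace m n) :
    inner ℝ (lift P Q u) (lift P Q v) = inner ℝ u v := by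
  rw [inner_lift, diagPart_lift hP hQ]

lemma norm_lift (hP : P ∈ Matrix.orthogonalGroup (Fin m) ℝ)
    (hQ : Q ∈ Matrix.orthogonalGroup (Fin n) ℝ) (u : VecSpace m n) :
    ‖lift P Q u‖ = ‖u‖ := by
  rw [norm_eq_sqrt_real_inner, inner_lift_lift hP hQ, ← norm_eq_sqrt_real_inner]

/-- Pythagoras: `lift ∘ diagPart` is the orthogonal projection onto the lifts. -/
lemma norm_sub_lift_sq (hP : P ∈ Matrix.orthogonalGroup (Fin m) ℝ)
    (hQ : Q ∈ Matrix.orthogonalGroup (Fin n) ℝ) (U : MatSpace m n) (w : VecSpace m n) :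
    ‖U - lift P Q w‖ ^ 2 =
      ‖U - lift P Q (diagPart P Q U)‖ ^ 2 + ‖diagPart P Q U - w‖ ^ 2 := by
  rw [norm_sub_sq_real, norm_sub_sq_real, norm_sub_sq_real, real_inner_comm, inner_lift,
    real_inner_comm, real_inner_comm _ U, inner_lift, norm_lift hP hQ, norm_lift hP hQ,
    real_inner_self_eq_norm_sq]
  ring

lemma sorted_singVals (U : MatSpace m n) : Sorted (singVals U) :=
  ⟨fun _ _ hij => LinearMap.singularValues_antitone _ hij,
    fun _ => LinearMap.singularValues_nonneg _ _⟩

end Matrices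

/-! ### Singular values of lifts, SVD, von Neumann's inequality and majorization. -/

section SingularValues

open Polynomial in
/-- A sorted family whose associated monic polynomial is the characteristic polynomial of a
symmetric operator is the family of its eigenvalues. -/
lemma eigenvalues_eq_of_charpoly {E : Type*} [NormedAddCommGroup E] [InnerProductSpace ℝ E]
    [FiniteDimensional ℝ E] {T : E →ₗ[ℝ] E} (hT : T.IsSymmetric) {n : ℕ}
    (hn : Module.finrank ℝ E = n) {d : Fin n → ℝ} (hd : Antitone d)
    (h : T.charpoly = ∏ i, (X - C (d i))) : hT.eigenvalues hn = d := by
  have hroots : T.charpoly.roots = Multiset.map d Finset.univ.val := by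
    rw [h, Polynomial.roots_prod _ _ (by
      simp [Finset.prod_ne_zero_iff, Polynomial.X_sub_C_ne_zero])]
    simp
  rw [← List.ofFn_inj, ← hT.sort_roots_charpoly_eq_eigenvalues hn, hroots]
  simp_rw [Fin.univ_val_map, Multiset.map_coe, List.map_ofFn, Function.comp_def,
    RCLike.re_to_real, Multiset.coe_sort]
  convert! List.mergeSort_of_pairwise ?_
  simp_rw [decide_eq_true_eq, ← List.sortedGE_iff_pairwise]
  exact hd.sortedGE_ofFn

variable {m n : ℕ}

/-- The squared diagonal of a rectangular diagonal matrix, padded with zeros to length `n`. -/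
def sqDiag (w : VecSpace m n) (j : Fin n) : ℝ :=
  if h : (j : ℕ) < m then w ⟨j, lt_min h j.isLt⟩ ^ 2 else 0

lemma conjTranspose_dg_mul_dg (w : VecSpace m n) :
    (dg w).conjTranspose * dg w = Matrix.diagonal (sqDiag w) := by
  ext j k
  rw [Matrix.mul_apply, Matrix.diagonal_apply, sqDiag]
  simp only [Matrix.conjTranspose_apply, star_trivial, dg, Matrix.of_apply]
  split_ifs with hjk hj
  · subst hjk
    rw [Finset.sum_eq_single_of_mem (⟨j, hj⟩ : Fin m) (Finset.mem_univ _)]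
    · simp [sq]
    · intro a _ ha
      rw [dif_neg fun h => ha (Fin.ext h)]
      simp
  · refine Finset.sum_eq_zero fun a _ => ?_
    rw [dif_neg fun h : (a : ℕ) = j => hj (h ▸ a.isLt)]
    simp
  · refine Finset.sum_eq_zero fun a _ => ?_
    by_cases h : (a : ℕ) = j
    · rw [dif_neg fun h' : (a : ℕ) = k => hjk (Fin.ext (h.symm.trans h')), mul_zero]
    · rw [dif_neg h, zero_mul]

open Polynomial in
-- This separates the squared entries, which may be permuted freely, from the padding zeros at fixed
-- positions.
lemma prod_X_sub_sqDiag (w : VecSpace m n) :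
    ∏ j, (X - C (sqDiag w j)) = (∏ i : Fin (min m n), (X - C (w i ^ 2))) *
      ∏ _j ∈ (Finset.univ.map (Fin.castLEEmb (min_le_right m n)))ᶜ, (X : ℝ[X]) := by
  rw [← Finset.prod_mul_prod_compl (Finset.univ.map (Fin.castLEEmb (min_le_right m n))),
    Finset.prod_map]
  congr 1
  · refine Finset.prod_congr rfl fun i _ => ?_
    have hi : (i : ℕ) < m := i.isLt.trans_le (min_le_left _ _)
    simp [sqDiag, hi]
  · refine Finset.prod_congr rfl fun j (hj : j ∈ _) => ?_
    have hj' : ¬ (j : ℕ) < m := by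
      intro hjm
      refine Finset.mem_compl.1 hj (Finset.mem_map.2 ⟨⟨j, lt_min hjm j.isLt⟩,
        Finset.mem_univ _, ?_⟩)
      ext
      simp
    simp [sqDiag, hj']

variable {P : Matrix (Fin m) (Fin m) ℝ} {Q : Matrix (Fin n) (Fin n) ℝ}

lemma antitone_sqDiag {x : VecSpace m n} (hx : Sorted x) : Antitone (sqDiag x) := by
  intro j k hjk
  rw [sqDiag, sqDiag]
  split_ifs with h1 h2 h2
  · exact pow_le_pow_left₀ (hx.2 _) (hx.1 _ _ hjk) 2
  · exact absurd (lt_of_le_of_lt (show (j : ℕ) ≤ k from hjk) h1) h2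
  · positivity
  · exact le_rfl

/-- The singular values of `P (dg w) Q^*` are the decreasing rearrangement of `|w|`. -/
lemma singVals_lift_rearr (hP : P ∈ Matrix.orthogonalGroup (Fin m) ℝ)
    (hQ : Q ∈ Matrix.orthogonalGroup (Fin n) ℝ) {x : VecSpace m n} (hx : Sorted x)
    (π : Equiv.Perm (Fin (min m n))) (s : Fin (min m n) → ℤˣ) :
    singVals (lift P Q (rearr π s x)) = x := by
  set w := rearr π s x with hw
  set A := toMat (lift P Q w) with hA
  set T := Matrix.toEuclideanLin A with hT
  have hn : Module.finrank ℝ (EuclideanSpace ℝ (Fin n)) = n := finrank_euclideanSpace_fin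
  have hAA : A.conjTranspose * A =
      Q * (Matrix.diagonal (sqDiag w) * Q.conjTranspose) := by
    rw [hA, toMat_lift, Matrix.conjTranspose_mul, Matrix.conjTranspose_mul,
      Matrix.conjTranspose_conjTranspose, ← conjTranspose_dg_mul_dg]
    calc Q * ((dg w).conjTranspose * P.conjTranspose) * (P * dg w * Q.conjTranspose)
        = Q * ((dg w).conjTranspose * (P.conjTranspose * P) * dg w * Q.conjTranspose) := by
          simp only [Matrix.mul_assoc]
      _ = _ := by rw [conjTranspose_mul_self hP, Matrix.mul_one]
  have hcomp : LinearMap.adjoint T ∘ₗ T = Matrix.toEuclideanLin (A.conjTranspose * A) := by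
    rw [hT, ← Matrix.toEuclideanLin_conjTranspose_eq_adjoint]
    simp only [Matrix.toLpLin_eq_toLin]
    rw [← Matrix.toLin_mul]
  -- The characteristic polynomial of AᵀA depends only on the multiset of squared entries of w, so w
  -- can be replaced by the sorted x.
  have hchar : (LinearMap.adjoint T ∘ₗ T).charpoly =
      ∏ j, (Polynomial.X - Polynomial.C (sqDiag x j)) := by
    rw [hcomp, Matrix.toEuclideanLin, Matrix.toLpLin_eq_toLin, Matrix.charpoly_toLin, hAA,
      Matrix.charpoly_mul_comm, Matrix.mul_assoc, conjTranspose_mul_self hQ, Matrix.mul_one,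
      Matrix.charpoly_diagonal, prod_X_sub_sqDiag, prod_X_sub_sqDiag]
    congr 1
    rw [← Equiv.prod_comp π fun i => Polynomial.X - Polynomial.C (x i ^ 2)]
    refine Finset.prod_congr rfl fun i _ => ?_
    have : w i ^ 2 = x (π i) ^ 2 := by
      rw [hw, rearr_apply, mul_pow, sq ((s i : ℤ) : ℝ), intUnit_mul_self, one_mul]
    rw [this]
  have heig := eigenvalues_eq_of_charpoly T.isSymmetric_adjoint_comp_self hn
    (antitone_sqDiag hx) hchar
  ext i
  have h1 := T.singularValues_fin hn (colIdx i)
  rw [heig] at h1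
  have hi : ((colIdx i : Fin n) : ℕ) < m := i.isLt.trans_le (min_le_left _ _)
  rw [sqDiag, dif_pos hi] at h1
  exact h1.trans (Real.sqrt_sq (hx.2 _))

lemma AbsSymmetric.apply_singVals_lift {α : Type*} {f : VecSpace m n → α} (hf : AbsSymmetric f)
    (hP : P ∈ Matrix.orthogonalGroup (Fin m) ℝ) (hQ : Q ∈ Matrix.orthogonalGroup (Fin n) ℝ)
    (w : VecSpace m n) : f (singVals (lift P Q w)) = f w := by
  obtain ⟨π, s, x, hx, rfl⟩ := exists_eq_rearr w
  rw [singVals_lift_rearr hP hQ hx, hf.rearr]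

lemma mem_orthogonalGroup_of_basis {k : ℕ}
    (b : OrthonormalBasis (Fin k) ℝ (EuclideanSpace ℝ (Fin k))) :
    (Matrix.of fun a i => b i a) ∈ Matrix.orthogonalGroup (Fin k) ℝ := by
  refine (Matrix.mem_orthogonalGroup_iff' _ _).2 ?_
  ext i j
  have h := orthonormal_iff_ite.1 b.orthonormal i j
  rw [PiLp.inner_apply] at h
  simp only [RCLike.inner_apply, conj_trivial] at h
  simp only [Matrix.mul_apply, Matrix.transpose_apply, Matrix.of_apply, Matrix.one_apply]
  rw [← h]
  exact Finset.sum_congr rfl fun a _ => mul_comm _ _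

/-- Every matrix has a singular value decomposition. -/
theorem exists_isSVD (U : MatSpace m n) : ∃ P Q, IsSVD P Q U := by
  set T := Matrix.toEuclideanLin (toMat U) with hT
  have hn : Module.finrank ℝ (EuclideanSpace ℝ (Fin n)) = n := finrank_euclideanSpace_fin
  have hm : Module.finrank ℝ (EuclideanSpace ℝ (Fin m)) = m := finrank_euclideanSpace_fin
  set b := T.isSymmetric_adjoint_comp_self.eigenvectorBasis hn with hb
  have hinner : ∀ i j, inner ℝ (T (b i)) (T (b j)) =
      if i = j then T.singularValues j ^ 2 else 0 := by
    intro i j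
    rw [← LinearMap.adjoint_inner_right, ← LinearMap.comp_apply,
      T.isSymmetric_adjoint_comp_self.apply_eigenvectorBasis hn j, ← hb, inner_smul_right,
      orthonormal_iff_ite.1 b.orthonormal i j, ← T.sq_singularValues_fin hn]
    split_ifs <;> simp
  -- Left singular vectors, orthonormal only where the singular value is nonzero; the remaining ones
  -- are filled in by extending to a basis.
  set v : Fin m → EuclideanSpace ℝ (Fin m) := fun i =>
    if h : (i : ℕ) < n then (T.singularValues i)⁻¹ • T (b ⟨i, h⟩) else 0 with hv
  set S : Set (Fin m) := {i | (i : ℕ) < n ∧ T.singularValues i ≠ 0} with hS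
  have hvS : Orthonormal ℝ (S.domRestrict v) := by
    rw [orthonormal_iff_ite]
    rintro ⟨i, hi, hi0⟩ ⟨j, hj, hj0⟩
    simp only [Set.domRestrict_apply, hv, hi, hj, dif_pos, real_inner_smul_left,
      real_inner_smul_right, hinner, Fin.mk.injEq, Subtype.mk.injEq]
    by_cases hij : i = j
    · subst hij
      simp only [if_true]
      field_simp
    · rw [if_neg (fun h => hij (Fin.ext h)), if_neg hij]
      simp
  obtain ⟨b', hb'⟩ := hvS.exists_orthonormalBasis_extension_of_card_eq (by simp [hm])
  have hTb : ∀ j : Fin n, T (b j) =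
      if h : (j : ℕ) < m then T.singularValues j • b' ⟨j, h⟩ else 0 := by
    intro j
    by_cases h0 : T.singularValues j = 0
    · have : T (b j) = 0 := by
        have := hinner j j
        rw [if_pos rfl, h0, real_inner_self_eq_norm_sq] at this
        simpa using this
      rw [this, h0]
      simp
    -- An index j ≥ m is at least the rank, so its singular value would vanish.
    · have hj : (j : ℕ) < m := by
        by_contra hj
        refine h0 (T.singularValues_eq_zero_iff_le_finrank_range.2 ?_)
        exact (Submodule.finrank_le _).trans (hm.le.trans (not_lt.1 hj))
      rw [dif_pos hj, hb' ⟨j, hj⟩ ⟨j.isLt, h0⟩]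
      simp only [hv, j.isLt, dif_pos]
      rw [smul_smul, mul_inv_cancel₀ h0, one_smul]
  set P : Matrix (Fin m) (Fin m) ℝ := Matrix.of fun a i => b' i a with hPdef
  set Q : Matrix (Fin n) (Fin n) ℝ := Matrix.of fun a i => b i a with hQdef
  have hP : P ∈ Matrix.orthogonalGroup (Fin m) ℝ := mem_orthogonalGroup_of_basis b'
  have hQ : Q ∈ Matrix.orthogonalGroup (Fin n) ℝ := mem_orthogonalGroup_of_basis b
  have hmul : toMat U * Q = P * dg (singVals U) := by
    ext a j
    have h1 : (toMat U * Q) a j = T (b j) a := by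
      rw [hT, Matrix.ofLp_toLpLin]
      rfl
    rw [h1, hTb, Matrix.mul_apply]
    split_ifs with h
    · rw [Finset.sum_eq_single_of_mem (⟨j, h⟩ : Fin m) (Finset.mem_univ _)]
      · simp only [dg, Matrix.of_apply, dif_pos, singVals, hPdef, ← hT, PiLp.smul_apply,
          smul_eq_mul]
        rw [mul_comm]
      · intro k _ hk
        simp only [dg, Matrix.of_apply]
        rw [dif_neg fun h' => hk (Fin.ext h'), mul_zero]
    · refine (Finset.sum_eq_zero fun k _ => ?_).symm
      simp only [dg, Matrix.of_apply]
      rw [dif_neg fun h' : (k : ℕ) = j => h (h' ▸ k.isLt), mul_zero]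
  refine ⟨P, Q, hP, hQ, ?_⟩
  have h2 : toMat U = P * dg (singVals U) * Q.conjTranspose := by
    rw [← hmul, Matrix.mul_assoc, mul_conjTranspose_self hQ, Matrix.mul_one]
  ext ⟨a, c⟩
  rw [lift, ← h2]
  rfl

lemma norm_singVals (U : MatSpace m n) : ‖singVals U‖ = ‖U‖ := by
  obtain ⟨P, Q, hP, hQ, hU⟩ := exists_isSVD U
  conv_rhs => rw [hU, norm_lift hP hQ]

lemma sum_sq_row {k : ℕ} {A : Matrix (Fin k) (Fin k) ℝ}
    (hA : A ∈ Matrix.orthogonalGroup (Fin k) ℝ) (i : Fin k) : ∑ j, A i j ^ 2 = 1 := by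
  have h := congrFun (congrFun (mul_conjTranspose_self hA) i) i
  simp only [Matrix.mul_apply, Matrix.conjTranspose_apply, star_trivial, Matrix.one_apply_eq] at h
  simpa only [sq] using h

lemma sum_sq_col {k : ℕ} {A : Matrix (Fin k) (Fin k) ℝ}
    (hA : A ∈ Matrix.orthogonalGroup (Fin k) ℝ) (j : Fin k) : ∑ i, A i j ^ 2 = 1 := by
  have h := congrFun (congrFun (conjTranspose_mul_self hA) j) j
  simp only [Matrix.mul_apply, Matrix.conjTranspose_apply, star_trivial, Matrix.one_apply_eq] at h
  simpa only [sq] using h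

lemma sum_castLE_le {k r : ℕ} (hr : r ≤ k) {f : Fin k → ℝ} (hf : ∀ i, 0 ≤ f i) :
    ∑ i : Fin r, f (Fin.castLE hr i) ≤ ∑ i, f i := by
  exact (Finset.sum_map Finset.univ (Fin.castLEEmb hr) f).symm.trans_le
    (Finset.sum_le_univ_sum_of_nonneg hf)

lemma conjTranspose_mul_mem {k : ℕ} {A B : Matrix (Fin k) (Fin k) ℝ}
    (hA : A ∈ Matrix.orthogonalGroup (Fin k) ℝ) (hB : B ∈ Matrix.orthogonalGroup (Fin k) ℝ) :
    A.conjTranspose * B ∈ Matrix.orthogonalGroup (Fin k) ℝ := by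
  rw [← Matrix.star_eq_conjTranspose]
  exact mul_mem (Unitary.star_mem hA) hB

lemma diagPart_lift_apply (P P' : Matrix (Fin m) (Fin m) ℝ) (Q Q' : Matrix (Fin n) (Fin n) ℝ)
    (w : VecSpace m n) (i : Fin (min m n)) : diagPart P Q (lift P' Q' w) i =
      ∑ k, (P.conjTranspose * P') (rowIdx i) (rowIdx k) * w k *
        (Q.conjTranspose * Q') (colIdx i) (colIdx k) := by
  simp only [diagPart_apply, lift_apply, Matrix.mul_apply, Matrix.conjTranspose_apply,
    star_trivial, Finset.sum_mul, Finset.mul_sum]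
  rw [Finset.sum_congr rfl fun a _ => Finset.sum_comm, Finset.sum_comm]
  refine Finset.sum_congr rfl fun k _ => ?_
  rw [Finset.sum_comm]
  refine Finset.sum_congr rfl fun b _ => Finset.sum_congr rfl fun a _ => ?_
  ring

/-- Von Neumann's trace inequality. -/
theorem inner_lift_rearr_le (hP : P ∈ Matrix.orthogonalGroup (Fin m) ℝ)
    (hQ : Q ∈ Matrix.orthogonalGroup (Fin n) ℝ) {x : VecSpace m n} (hx : Sorted x)
    (π : Equiv.Perm (Fin (min m n))) (s : Fin (min m n) → ℤˣ) (U : MatSpace m n) :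
    inner ℝ (lift P Q (rearr π s x)) U ≤ inner ℝ x (singVals U) := by
  obtain ⟨P', Q', hP', hQ', hU⟩ := exists_isSVD U
  set τ := singVals U with hτdef
  have hτ : Sorted τ := sorted_singVals U
  set A := P.conjTranspose * P' with hA
  set B := Q.conjTranspose * Q' with hB
  have hAo : A ∈ Matrix.orthogonalGroup (Fin m) ℝ := conjTranspose_mul_mem hP hP'
  have hBo : B ∈ Matrix.orthogonalGroup (Fin n) ℝ := conjTranspose_mul_mem hQ hQ'
  -- By ±pq ≤ (p² + q²)/2 these averages dominate the signed products of entries. They are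
  -- substochastic because orthogonal matrices have unit rows and columns; `π.symm` absorbs the
  -- permutation.
  set c : Fin (min m n) → Fin (min m n) → ℝ := fun i k =>
    (A (rowIdx (π.symm i)) (rowIdx k) ^ 2 + B (colIdx (π.symm i)) (colIdx k) ^ 2) / 2 with hc
  have hrow : ∀ i, ∑ k, c i k ≤ 1 := by
    intro i
    have h1 := sum_castLE_le (min_le_left m n) (f := fun k => A (rowIdx (π.symm i)) k ^ 2)
      fun _ => sq_nonneg _
    have h2 := sum_castLE_le (min_le_right m n) (f := fun k => B (colIdx (π.symm i)) k ^ 2)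
      fun _ => sq_nonneg _
    rw [sum_sq_row hAo] at h1
    rw [sum_sq_row hBo] at h2
    simp only [hc]
    rw [← Finset.sum_div, Finset.sum_add_distrib]
    linarith
  have hcol : ∀ k, ∑ i, c i k ≤ 1 := by
    intro k
    have h1 := sum_castLE_le (min_le_left m n) (f := fun i => A i (rowIdx k) ^ 2)
      fun _ => sq_nonneg _
    have h2 := sum_castLE_le (min_le_right m n) (f := fun i => B i (colIdx k) ^ 2)
      fun _ => sq_nonneg _
    rw [sum_sq_col hAo] at h1
    rw [sum_sq_col hBo] at h2
    simp only [hc]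
    rw [← Finset.sum_div, Finset.sum_add_distrib,
      Equiv.sum_comp π.symm fun i => A (rowIdx i) (rowIdx k) ^ 2,
      Equiv.sum_comp π.symm fun i => B (colIdx i) (colIdx k) ^ 2]
    linarith
  have hmain := sum_mul_le_of_substochastic (c := c) (fun i k => by simp only [hc]; positivity)
    hrow hcol hx.1 hx.2 hτ.1 hτ.2
  have hright : inner ℝ x τ = ∑ i, x i * τ i := by
    rw [PiLp.inner_apply]
    exact Finset.sum_congr rfl fun i _ => by simp [mul_comm]
  have hleft : inner ℝ (lift P Q (rearr π s x)) U =
      ∑ i, ∑ k, ((s i : ℤ) : ℝ) * x (π i) *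
        (A (rowIdx i) (rowIdx k) * τ k * B (colIdx i) (colIdx k)) := by
    rw [inner_lift, hU, PiLp.inner_apply]
    refine Finset.sum_congr rfl fun i _ => ?_
    rw [diagPart_lift_apply, ← Finset.mul_sum]
    simp only [RCLike.inner_apply, conj_trivial, rearr_apply]
    exact mul_comm _ _
  rw [hright, hleft]
  refine le_trans ?_ hmain
  rw [← Equiv.sum_comp π fun i => ∑ k, c i k * (x i * τ k)]
  refine Finset.sum_le_sum fun i _ => Finset.sum_le_sum fun k _ => ?_
  simp only [hc, Equiv.symm_apply_apply]
  have hxτ : 0 ≤ x (π i) * τ k := mul_nonneg (hx.2 _) (hτ.2 _)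
  have habs : ((s i : ℤ) : ℝ) * (A (rowIdx i) (rowIdx k) * B (colIdx i) (colIdx k)) ≤
      (A (rowIdx i) (rowIdx k) ^ 2 + B (colIdx i) (colIdx k) ^ 2) / 2 := by
    generalize A (rowIdx i) (rowIdx k) = p
    generalize B (colIdx i) (colIdx k) = q
    rcases Int.units_eq_one_or (s i) with h | h
    · simp only [h, Units.val_one, Int.cast_one, one_mul]
      nlinarith [sq_nonneg (p - q)]
    · simp only [h, Units.val_neg, Units.val_one, Int.cast_neg, Int.cast_one]
      nlinarith [sq_nonneg (p + q)]
  have := mul_le_mul_of_nonneg_right habs hxτ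
  linarith

/-- The diagonal of `P^* U Q` is majorized by the singular values of `U`. -/
theorem diagPart_mem_convexHull (hP : P ∈ Matrix.orthogonalGroup (Fin m) ℝ)
    (hQ : Q ∈ Matrix.orthogonalGroup (Fin n) ℝ) (U : MatSpace m n) :
    diagPart P Q U ∈ convexHull ℝ (Set.range fun p : Equiv.Perm (Fin (min m n)) ×
      (Fin (min m n) → ℤˣ) => rearr p.1 p.2 (singVals U)) := by
  by_contra hnot
  -- Signs in the finite type `ℤˣ` leave finitely many vertices, so the hull is closed and a point
  -- outside it can be strictly separated.
  obtain ⟨f, u, hf, hu⟩ := geometric_hahn_banach_closed_point (convex_convexHull ℝ _)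
    ((Set.finite_range _).isClosed_convexHull ℝ) hnot
  set w := (InnerProductSpace.toDual ℝ (VecSpace m n)).symm f with hw
  have hfw : ∀ z, f z = inner ℝ w z := fun z => by
    rw [hw, InnerProductSpace.toDual_symm_apply]
  -- The signed permutation that produces w from sorted x, applied to σ(U), gives a vertex where the
  -- functional equals ⟨x, σ(U)⟩, the bound of von Neumann's inequality.
  obtain ⟨π, s, x, hx, hwx⟩ := exists_eq_rearr w
  have h1 := hf _ (subset_convexHull ℝ _ ⟨(π, s), rfl⟩)
  have h2 := inner_lift_rearr_le hP hQ hx π s U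
  rw [hfw, hwx, LinearIsometryEquiv.inner_map_map] at h1
  rw [hfw, hwx, ← inner_lift] at hu
  linarith

end SingularValues

/-! ### Gradients under isometries and for convex functions. -/

section Gradients

variable {E : Type*} [NormedAddCommGroup E] [InnerProductSpace ℝ E] [CompleteSpace E]

lemma hasGradientAt_of_isometry_invariant {f : E → ℝ} {g x : E} (h : HasGradientAt f g x)
    (L : E ≃ₗᵢ[ℝ] E) (hL : ∀ z, f (L z) = f z) : HasGradientAt f (L.symm g) (L.symm x) := by
  rw [hasGradientAt_iff_hasFDerivAt] at h ⊢
  have h1 : HasFDerivAt f (InnerProductSpace.toDual ℝ E g) (L (L.symm x)) := by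
    rwa [LinearIsometryEquiv.apply_symm_apply]
  have h2 := h1.comp (L.symm x) L.toContinuousLinearEquiv.hasFDerivAt
  have h3 : f ∘ L = f := funext hL
  convert! h2 using 1
  · exact h3.symm
  · ext z
    simp only [InnerProductSpace.toDual_apply_apply, ContinuousLinearMap.comp_apply]
    rw [← LinearIsometryEquiv.inner_map_map L, LinearIsometryEquiv.apply_symm_apply]
    rfl

lemma gradient_fixed_of_isometry_invariant {f : E → ℝ} {g x : E} (h : HasGradientAt f g x)
    (L : E ≃ₗᵢ[ℝ] E) (hL : ∀ z, f (L z) = f z) (hx : L x = x) : L g = g := by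
  have h1 := hasGradientAt_of_isometry_invariant h L hL
  have hx' : L.symm x = x := by
    rw [LinearIsometryEquiv.symm_apply_eq, hx]
  rw [hx'] at h1
  have h2 := h1.unique h
  rw [LinearIsometryEquiv.symm_apply_eq] at h2
  exact h2.symm

/-- The gradient of a composite prox objective. -/
lemma hasGradientAt_proxShift {f : E → ℝ} {g z : E} (h : HasGradientAt f g z) (lam c : ℝ) (s : E) :
    HasGradientAt (fun u => lam * f u - inner ℝ s u + 1 / 2 * ‖u‖ ^ 2 + c) (lam • g - s + z) z := by
  rw [hasGradientAt_iff_hasFDerivAt] at h ⊢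
  have h1 := (((h.const_mul lam).sub (innerSL ℝ s).hasFDerivAt).add
    ((hasStrictFDerivAt_norm_sq z).hasFDerivAt.const_mul (1 / 2))).add_const c
  convert! h1 using 1
  ext u
  simp

lemma linApprox_le_of_convexOn {f : E → ℝ} (hf : ConvexOn ℝ Set.univ f) {z : E}
    (hd : DifferentiableAt ℝ f z) (u : E) : linApprox f u z ≤ f u := by
  have hline : HasDerivAt (fun t : ℝ => z + t • (u - z)) (u - z) 0 := by
    simpa using ((hasDerivAt_id (0 : ℝ)).smul_const (u - z)).const_add z
  have hg : HasFDerivAt f (InnerProductSpace.toDual ℝ E (gradient f z)) (z + (0 : ℝ) • (u - z)) := by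
    rw [zero_smul, add_zero]
    exact hd.hasGradientAt.hasFDerivAt
  have hφ := hg.comp_hasDerivAt (0 : ℝ) hline
  have hconv : ConvexOn ℝ Set.univ (f ∘ fun t : ℝ => z + t • (u - z)) := by
    refine ⟨convex_univ, fun a _ b _ p q hp hq hpq => ?_⟩
    have := hf.2 (Set.mem_univ (z + a • (u - z))) (Set.mem_univ (z + b • (u - z))) hp hq hpq
    obtain rfl : q = 1 - p := by linarith
    have e : z + (p • a + (1 - p) • b) • (u - z) =
        p • (z + a • (u - z)) + (1 - p) • (z + b • (u - z)) := by
      simp only [smul_eq_mul]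
      module
    simpa only [Function.comp_apply, e] using this
  have := hconv.le_slope_of_hasDerivAt (Set.mem_univ 0) (Set.mem_univ 1) zero_lt_one hφ
  simp only [slope_def_field, Function.comp_apply, zero_smul, add_zero, one_smul, sub_zero,
    add_sub_cancel, div_one, InnerProductSpace.toDual_apply_apply] at this
  rw [linApprox]
  linarith

end Gradients

/-! ### Gradients and convexity of spectral functions. -/

section SpectralGradient

variable {r : ℕ}

/-- Strict inequalities survive small perturbations; ties and zeros survive because g respects them.
-/
lemma eventually_sorted_add_smul {y g : EuclideanSpace ℝ (Fin r)} (hy : Sorted y)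
    (hg : ∀ i j, y i = y j → g i = g j) (hg0 : ∀ i, y i = 0 → g i = 0) :
    ∀ᶠ t : ℝ in nhds 0, Sorted (y + t • g) := by
  have h1 : ∀ i j, ∀ᶠ t : ℝ in nhds 0, i ≤ j → (y + t • g) j ≤ (y + t • g) i := by
    intro i j
    by_cases hij : i ≤ j
    · rcases (hy.1 i j hij).eq_or_lt with h | h
      · refine Filter.Eventually.of_forall fun t _ => ?_
        simp [h, hg j i h]
      · have hc : Continuous fun t : ℝ => (y i + t * g i) - (y j + t * g j) := by fun_prop
        have := hc.tendsto 0
        simp only [zero_mul, add_zero] at this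
        filter_upwards [this.eventually (lt_mem_nhds (sub_pos.2 h))] with t ht _
        simp only [PiLp.add_apply, PiLp.smul_apply, smul_eq_mul]
        linarith
    · exact Filter.Eventually.of_forall fun t h => absurd h hij
  have h2 : ∀ i, ∀ᶠ t : ℝ in nhds 0, 0 ≤ (y + t • g) i := by
    intro i
    rcases (hy.2 i).eq_or_lt with h | h
    · refine Filter.Eventually.of_forall fun t => ?_
      simp [← h, hg0 i h.symm]
    · have hc : Continuous fun t : ℝ => y i + t * g i := by fun_prop
      have := hc.tendsto 0
      simp only [zero_mul, add_zero] at this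
      filter_upwards [this.eventually (lt_mem_nhds h)] with t ht
      simp only [PiLp.add_apply, PiLp.smul_apply, smul_eq_mul]
      exact ht.le
  filter_upwards [Filter.eventually_all.2 fun i => Filter.eventually_all.2 fun j => h1 i j,
    Filter.eventually_all.2 h2] with t ht1 ht2
  exact ⟨ht1, ht2⟩

/-- The gradient of an absolutely symmetric function at a sorted point is compatible with the ties
and the zeros of the point. -/
lemma AbsSymmetric.gradient_ties {f : EuclideanSpace ℝ (Fin r) → ℝ} (hf : AbsSymmetric f)
    {y g : EuclideanSpace ℝ (Fin r)} (h : HasGradientAt f g y) :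
    (∀ i j, y i = y j → g i = g j) ∧ ∀ i, y i = 0 → g i = 0 := by
  refine ⟨fun i j hij => ?_, fun i hi => ?_⟩
  · have h1 := gradient_fixed_of_isometry_invariant h (SpectralACG.rearr (Equiv.swap i j) 1)
      (hf.rearr _ _) (by
        ext k
        simp only [rearr_apply, Pi.one_apply, Units.val_one, Int.cast_one, one_mul]
        rcases eq_or_ne k i with rfl | hki
        · rw [Equiv.swap_apply_left, hij]
        · rcases eq_or_ne k j with rfl | hkj
          · rw [Equiv.swap_apply_right, hij]
          · rw [Equiv.swap_apply_of_ne_of_ne hki hkj])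
    have h2 := congrArg (fun w : EuclideanSpace ℝ (Fin r) => w i) h1
    simp only [rearr_apply, Pi.one_apply, Units.val_one, Int.cast_one, one_mul,
      Equiv.swap_apply_left] at h2
    exact h2.symm
  · have h1 := gradient_fixed_of_isometry_invariant h
      (SpectralACG.rearr 1 (Function.update (1 : Fin r → ℤˣ) i (-1)))
      (hf.rearr _ _) (by
        ext k
        rcases eq_or_ne k i with rfl | hki
        · simp [hi]
        · simp [hki])
    have h2 := congrArg (fun w : EuclideanSpace ℝ (Fin r) => w i) h1
    simp at h2
    linarith

variable {m n : ℕ} {P : Matrix (Fin m) (Fin m) ℝ} {Q : Matrix (Fin n) (Fin n) ℝ}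

/-- A second-order comparison of the singular values of a perturbation of `P (dg y) Q^*` with the
first-order change in a direction `g` that respects the order of `y`. -/
lemma abs_inner_rearr_singVals_sub_le (hP : P ∈ Matrix.orthogonalGroup (Fin m) ℝ)
    (hQ : Q ∈ Matrix.orthogonalGroup (Fin n) ℝ) {y g : VecSpace m n} {τ : ℝ} (hτ : 0 < τ)
    (hy : Sorted y) (h₁ : Sorted (y + τ • g)) (h₂ : Sorted (y + (-τ) • g))
    (π : Equiv.Perm (Fin (min m n))) (s : Fin (min m n) → ℤˣ) (A : MatSpace m n) :
    ‖rearr π s (singVals A) - rearr π s y‖ ≤ ‖A - lift P Q (rearr π s y)‖ ∧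
    |inner ℝ (rearr π s g) (rearr π s (singVals A) - rearr π s y) -
      inner ℝ (lift P Q (rearr π s g)) (A - lift P Q (rearr π s y))| ≤
      ‖A - lift P Q (rearr π s y)‖ ^ 2 / (2 * τ) := by
  -- Von Neumann at y and y ± τg: the last two bound τ times the error, with either sign, by ⟨y,
  -- σ(A)⟩ - ⟨lift y, A⟩, where lift y stands for the lift of the rearranged y. This is half the
  -- difference of the two squared distances computed below.
  have e0 := inner_lift_rearr_le hP hQ hy π s A
  have e1 := inner_lift_rearr_le hP hQ h₁ π s A
  have e2 := inner_lift_rearr_le hP hQ h₂ π s A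
  simp only [map_add, map_smul, lift_add, lift_smul, inner_add_left, real_inner_smul_left]
    at e1 e2
  have n1 : ‖rearr π s (singVals A) - rearr π s y‖ ^ 2 =
      ‖A‖ ^ 2 - 2 * inner ℝ y (singVals A) + ‖y‖ ^ 2 := by
    rw [norm_sub_sq_real, LinearIsometryEquiv.inner_map_map, LinearIsometryEquiv.norm_map,
      LinearIsometryEquiv.norm_map, norm_singVals, real_inner_comm]
  have n2 : ‖A - lift P Q (rearr π s y)‖ ^ 2 =
      ‖A‖ ^ 2 - 2 * inner ℝ (lift P Q (rearr π s y)) A + ‖y‖ ^ 2 := by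
    rw [norm_sub_sq_real, norm_lift hP hQ, LinearIsometryEquiv.norm_map, real_inner_comm]
  refine ⟨?_, ?_⟩
  · refine le_of_sq_le_sq ?_ (norm_nonneg _)
    linarith
  · have h3 : inner ℝ (rearr π s g) (rearr π s (singVals A) - rearr π s y) -
        inner ℝ (lift P Q (rearr π s g)) (A - lift P Q (rearr π s y)) =
        inner ℝ g (singVals A) - inner ℝ (lift P Q (rearr π s g)) A := by
      rw [inner_sub_right, inner_sub_right, inner_lift_lift hP hQ,
        LinearIsometryEquiv.inner_map_map]
      ring
    have h4 : 0 ≤ ‖rearr π s (singVals A) - rearr π s y‖ ^ 2 := sq_nonneg _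
    rw [h3, le_div_iff₀ (by positivity), mul_comm, ← abs_of_pos (by positivity : 0 < 2 * τ),
      ← abs_mul, abs_le]
    constructor <;> linarith

/-- A differentiable absolutely symmetric function of the singular values is differentiable, and its
gradient is the lift of the vector gradient. -/
theorem AbsSymmetric.hasGradientAt_comp_singVals {f : VecSpace m n → ℝ} (hf : AbsSymmetric f)
    (hP : P ∈ Matrix.orthogonalGroup (Fin m) ℝ) (hQ : Q ∈ Matrix.orthogonalGroup (Fin n) ℝ)
    {y g : VecSpace m n} (h : HasGradientAt f g y) :
    HasGradientAt (fun U => f (singVals U)) (lift P Q g) (lift P Q y) := by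
  obtain ⟨π, s, y', hy', hyy'⟩ := exists_eq_rearr y
  set g' := (SpectralACG.rearr π s).symm g with hg'
  have hgg' : g = SpectralACG.rearr π s g' := by
    rw [hg', LinearIsometryEquiv.apply_symm_apply]
  have hgrad := hasGradientAt_of_isometry_invariant h (SpectralACG.rearr π s) (hf.rearr π s)
  rw [← hg', hyy', LinearIsometryEquiv.symm_apply_apply] at hgrad
  obtain ⟨ht1, ht2⟩ := hf.gradient_ties hgrad
  have hev := eventually_sorted_add_smul hy' ht1 ht2
  have hneg : ∀ᶠ t : ℝ in nhds 0, Sorted (y' + (-t) • g') := by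
    have : Filter.Tendsto (fun t : ℝ => -t) (nhds 0) (nhds 0) := by
      simpa using (continuous_neg (G := ℝ)).tendsto 0
    exact this.eventually hev
  -- One τ serves all A, so the second-order error below has a fixed constant 1/(2τ).
  obtain ⟨τ, ⟨h₁, h₂⟩, hτ⟩ := (((hev.and hneg).filter_mono
    (nhdsWithin_le_nhds (s := Set.Ioi (0 : ℝ)))).and self_mem_nhdsWithin).exists
  have hτ : 0 < τ := hτ
  rw [hasGradientAt_iff_isLittleO, Asymptotics.isLittleO_iff] at h ⊢
  intro c hc
  have hfe := h (half_pos hc)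
  obtain ⟨δ, hδ, hfδ⟩ := Metric.eventually_nhds_iff.1 hfe
  -- Within distance cτ the second-order error is at most c/2 times the distance; the other c/2
  -- comes from differentiability of the vector function.
  refine Metric.eventually_nhds_iff.2 ⟨min δ (c * τ), lt_min hδ (by positivity), fun A hA => ?_⟩
  rw [dist_eq_norm] at hA
  obtain ⟨k1, k2⟩ := abs_inner_rearr_singVals_sub_le hP hQ hτ hy' h₁ h₂ π s A
  rw [← hyy', ← hgg'] at k2
  rw [← hyy'] at k1
  have k3 := hfδ (y := SpectralACG.rearr π s (singVals A)) (by
    rw [dist_eq_norm]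
    exact k1.trans_lt (hA.trans_le (min_le_left _ _)))
  rw [hf.rearr, Real.norm_eq_abs] at k3
  simp only [hf.apply_singVals_lift hP hQ]
  have k4 : ‖A - lift P Q y‖ ^ 2 / (2 * τ) ≤ c / 2 * ‖A - lift P Q y‖ := by
    rw [div_le_iff₀ (by positivity)]
    have := mul_le_mul_of_nonneg_right (hA.trans_le (min_le_right _ _)).le
      (norm_nonneg (A - lift P Q y))
    linarith
  have k5 : c / 2 * ‖SpectralACG.rearr π s (singVals A) - y‖ ≤ c / 2 * ‖A - lift P Q y‖ :=
    mul_le_mul_of_nonneg_left k1 (by positivity)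
  rw [Real.norm_eq_abs]
  rw [abs_le] at k2 k3 ⊢
  constructor <;> linarith [k2.1, k2.2, k3.1, k3.2]

/-- A convex function on a hull is dominated by its value at some vertex, and absolute symmetry
gives every vertex the value at σ(U). -/
lemma apply_diagPart_le_of_convexOn {f : VecSpace m n → ℝ} (hc : ConvexOn ℝ Set.univ f)
    (hf : AbsSymmetric f) (hP : P ∈ Matrix.orthogonalGroup (Fin m) ℝ)
    (hQ : Q ∈ Matrix.orthogonalGroup (Fin n) ℝ) (U : MatSpace m n) :
    f (diagPart P Q U) ≤ f (singVals U) := by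
  obtain ⟨_, ⟨p, rfl⟩, hp⟩ :=
    hc.exists_ge_of_mem_convexHull (Set.subset_univ _) (diagPart_mem_convexHull hP hQ U)
  rwa [hf.rearr] at hp

lemma ProperLscConvex.apply_diagPart_le {h : VecSpace m n → EReal} (hh : ProperLscConvex h)
    (hs : AbsSymmetric h) (hP : P ∈ Matrix.orthogonalGroup (Fin m) ℝ)
    (hQ : Q ∈ Matrix.orthogonalGroup (Fin n) ℝ) (U : MatSpace m n) :
    h (diagPart P Q U) ≤ h (singVals U) := by
  by_cases hU : h (singVals U) < ⊤
  · have hsub : (Set.range fun p : Equiv.Perm (Fin (min m n)) × (Fin (min m n) → ℤˣ) =>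
        SpectralACG.rearr p.1 p.2 (singVals U)) ⊆ {u | h u < ⊤} := by
      rintro _ ⟨p, rfl⟩
      change h _ < ⊤
      rwa [hs.rearr]
    have hmem := diagPart_mem_convexHull hP hQ U
    have hdom := convexHull_min hsub hh.convexOn.1 hmem
    obtain ⟨_, ⟨p, rfl⟩, hp⟩ := hh.convexOn.exists_ge_of_mem_convexHull hsub hmem
    simp only [hs.rearr] at hp
    rw [← hh.coe_toReal hU, ← hh.coe_toReal hdom]
    exact EReal.coe_le_coe_iff.2 hp
  · rw [not_lt_top_iff] at hU
    rw [hU]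
    exact le_top

/-- Restriction to rectangular diagonal matrices, that is, to lifts with P = Q = 1, recovers f. -/
lemma convexOn_of_comp_singVals {f : VecSpace m n → ℝ} (hf : AbsSymmetric f)
    (hc : ConvexOn ℝ Set.univ fun U : MatSpace m n => f (singVals U)) : ConvexOn ℝ Set.univ f := by
  have h1 : (1 : Matrix (Fin m) (Fin m) ℝ) ∈ Matrix.orthogonalGroup (Fin m) ℝ := one_mem _
  have h2 : (1 : Matrix (Fin n) (Fin n) ℝ) ∈ Matrix.orthogonalGroup (Fin n) ℝ := one_mem _
  refine ⟨convex_univ, fun u _ v _ a b ha hb hab => ?_⟩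
  have := hc.2 (Set.mem_univ (lift 1 1 u)) (Set.mem_univ (lift 1 1 v)) ha hb hab
  simp only at this
  rwa [← lift_smul, ← lift_smul, ← lift_add, hf.apply_singVals_lift h1 h2,
    hf.apply_singVals_lift h1 h2, hf.apply_singVals_lift h1 h2] at this

end SpectralGradient

/-! ### Transfer between the vector and matrix subproblems. -/

section Subproblems

variable {m n : ℕ} {M₂ lam θ : ℝ} {f₁ : MatSpace m n → ℝ} {f₂V : VecSpace m n → ℝ}
  {hV : VecSpace m n → EReal} {Z₀ : MatSpace m n}
  {P : Matrix (Fin m) (Fin m) ℝ} {Q : Matrix (Fin n) (Fin n) ℝ}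

/-- The constant by which the matrix and the vector objectives differ. -/
def offset (f₁ : MatSpace m n → ℝ) (lam : ℝ) (Z₀ : MatSpace m n) : ℝ :=
  lam * (f₁ Z₀ - inner ℝ (gradient f₁ Z₀) Z₀) + 1 / 2 * ‖Z₀‖ ^ 2

lemma matInput_ψs (U : MatSpace m n) : (matInput M₂ f₁ f₂V hV lam θ Z₀).ψs U =
    lam * f₂V (singVals U) - inner ℝ (shifted f₁ lam Z₀) U + 1 / 2 * ‖U‖ ^ 2
      + offset f₁ lam Z₀ := by
  simp only [matInput, linApprox, offset, shifted, inner_sub_left, inner_sub_right,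
    real_inner_smul_left, norm_sub_sq_real, real_inner_comm U Z₀]
  ring

/-- This is where the SVD of this particular matrix matters: the linear term depends on U only
through `diagPart`. -/
lemma inner_shifted (hP : IsSVD P Q (shifted f₁ lam Z₀)) (U : MatSpace m n) :
    inner ℝ (shifted f₁ lam Z₀) U = inner ℝ (singVals (shifted f₁ lam Z₀)) (diagPart P Q U) := by
  conv_lhs => rw [hP.2.2]
  rw [inner_lift]

lemma matInput_ψs_lift (hf : AbsSymmetric f₂V) (hS : IsSVD P Q (shifted f₁ lam Z₀))
    (u : VecSpace m n) : (matInput M₂ f₁ f₂V hV lam θ Z₀).ψs (lift P Q u) =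
      (vecInput M₂ f₁ f₂V hV lam θ Z₀ P Q).ψs u + offset f₁ lam Z₀ := by
  rw [matInput_ψs, inner_shifted hS, diagPart_lift hS.1 hS.2.1, norm_lift hS.1 hS.2.1,
    hf.apply_singVals_lift hS.1 hS.2.1]
  rfl

lemma matInput_ψn_lift (hh : AbsSymmetric hV) (hP : P ∈ Matrix.orthogonalGroup (Fin m) ℝ)
    (hQ : Q ∈ Matrix.orthogonalGroup (Fin n) ℝ) (u : VecSpace m n) :
    (matInput M₂ f₁ f₂V hV lam θ Z₀).ψn (lift P Q u) =
      (vecInput M₂ f₁ f₂V hV lam θ Z₀ P Q).ψn u := by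
  simp only [matInput, vecInput, hh.apply_singVals_lift hP hQ]

lemma vecInput_ψn_diagPart_le (hlam : 0 < lam) (hhV : ProperLscConvex hV)
    (hh : AbsSymmetric hV) (hP : P ∈ Matrix.orthogonalGroup (Fin m) ℝ)
    (hQ : Q ∈ Matrix.orthogonalGroup (Fin n) ℝ) (U : MatSpace m n) :
    (vecInput M₂ f₁ f₂V hV lam θ Z₀ P Q).ψn (diagPart P Q U) ≤
      (matInput M₂ f₁ f₂V hV lam θ Z₀).ψn U :=
  mul_le_mul_of_nonneg_left (hhV.apply_diagPart_le hh hP hQ U) (by exact_mod_cast hlam.le)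

lemma vecInput_ψn_proper (hlam : 0 < lam) (hhV : ProperLscConvex hV) :
    ProperLscConvex (vecInput M₂ f₁ f₂V hV lam θ Z₀ P Q).ψn :=
  hhV.const_mul hlam

lemma gradient_vecInput_ψs (hf₂V : Differentiable ℝ f₂V) (z : VecSpace m n) :
    gradient (vecInput M₂ f₁ f₂V hV lam θ Z₀ P Q).ψs z =
      lam • gradient f₂V z - singVals (shifted f₁ lam Z₀) + z := by
  have h := hasGradientAt_proxShift (hf₂V z).hasGradientAt lam 0 (singVals (shifted f₁ lam Z₀))
  simp only [add_zero] at h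
  exact h.gradient

lemma gradient_matInput_ψs_lift (hf₂V : Differentiable ℝ f₂V) (hf : AbsSymmetric f₂V)
    (hS : IsSVD P Q (shifted f₁ lam Z₀)) (z : VecSpace m n) :
    gradient (matInput M₂ f₁ f₂V hV lam θ Z₀).ψs (lift P Q z) =
      lift P Q (gradient (vecInput M₂ f₁ f₂V hV lam θ Z₀ P Q).ψs z) := by
  have h := hasGradientAt_proxShift
    (hf.hasGradientAt_comp_singVals hS.1 hS.2.1 (hf₂V z).hasGradientAt) lam (offset f₁ lam Z₀)
    (shifted f₁ lam Z₀)
  have hψ : (matInput M₂ f₁ f₂V hV lam θ Z₀).ψs = fun U =>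
      lam * f₂V (singVals U) - inner ℝ (shifted f₁ lam Z₀) U + 1 / 2 * ‖U‖ ^ 2
        + offset f₁ lam Z₀ := funext matInput_ψs
  rw [hψ, h.gradient, gradient_vecInput_ψs hf₂V, lift_add, lift_sub, lift_smul, ← hS.2.2]

/-- The vector start is the projection of Z₀ in lift coordinates; the part of Z₀ orthogonal to the
lifts only adds distance. -/
lemma norm_sub_x₀_le (hP : P ∈ Matrix.orthogonalGroup (Fin m) ℝ)
    (hQ : Q ∈ Matrix.orthogonalGroup (Fin n) ℝ) (y : VecSpace m n) :
    ‖y - (vecInput M₂ f₁ f₂V hV lam θ Z₀ P Q).x₀‖ ^ 2 ≤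
      ‖lift P Q y - (matInput M₂ f₁ f₂V hV lam θ Z₀).x₀‖ ^ 2 := by
  have h := norm_sub_lift_sq hP hQ Z₀ y
  have h1 : (vecInput M₂ f₁ f₂V hV lam θ Z₀ P Q).x₀ = diagPart P Q Z₀ := rfl
  have h2 : (matInput M₂ f₁ f₂V hV lam θ Z₀).x₀ = Z₀ := rfl
  rw [h1, h2, norm_sub_rev, norm_sub_rev (lift P Q y), h]
  exact le_add_of_nonneg_left (sq_nonneg _)

lemma matInput_val_lift (hf : AbsSymmetric f₂V) (hh : AbsSymmetric hV)
    (hS : IsSVD P Q (shifted f₁ lam Z₀)) (u : VecSpace m n) :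
    (matInput M₂ f₁ f₂V hV lam θ Z₀).val (lift P Q u) =
      (vecInput M₂ f₁ f₂V hV lam θ Z₀ P Q).val u + offset f₁ lam Z₀ := by
  rw [Input.val, Input.val, matInput_ψs_lift hf hS, matInput_ψn_lift hh hS.1 hS.2.1]
  ring

/-- The lift of a refined point of the vector problem is a refined point of the matrix problem. -/
theorem isRefined_lift (hlam : 0 < lam) (hf₂V : Differentiable ℝ f₂V) (hf : AbsSymmetric f₂V)
    (hhV : ProperLscConvex hV) (hh : AbsSymmetric hV) (hS : IsSVD P Q (shifted f₁ lam Z₀))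
    {y v zr : VecSpace m n} (hr : (vecInput M₂ f₁ f₂V hV lam θ Z₀ P Q).IsRefined y v zr) :
    (matInput M₂ f₁ f₂V hV lam θ Z₀).IsRefined (lift P Q y) (lift P Q v) (lift P Q zr) := by
  have hψn := vecInput_ψn_proper (M₂ := M₂) (f₁ := f₁) (f₂V := f₂V) (θ := θ) (Z₀ := Z₀) (P := P)
    (Q := Q) hlam hhV
  rw [Input.IsRefined, Input.refined_objective] at hr ⊢
  rw [gradient_matInput_ψs_lift hf₂V hf hS, ← lift_sub]
  set I := vecInput M₂ f₁ f₂V hV lam θ Z₀ P Q with hI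
  set J := matInput M₂ f₁ f₂V hV lam θ Z₀ with hJ
  have hM : J.M = I.M := rfl
  have hM0 : 0 < I.M := by
    have : 0 ≤ lam * max M₂ 0 := mul_nonneg hlam.le (le_max_right _ _)
    change 0 < lam * max M₂ 0 + 1
    linarith
  set g := gradient I.ψs y - v with hg
  rw [hM]
  have hzr := hψn.lt_top_of_isMin hr.le
  intro U hU
  have hlift : proxObj J.ψn 0 (lift P Q g) (lift P Q y) I.M (lift P Q zr) =
      proxObj I.ψn 0 g y I.M zr := by
    rw [proxObj, proxObj, inner_lift_lift hS.1 hS.2.1, ← lift_sub, norm_lift hS.1 hS.2.1,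
      matInput_ψn_lift hh hS.1 hS.2.1]
  rw [hlift]
  set u := diagPart P Q U with hu
  have hle : I.ψn u ≤ J.ψn U := vecInput_ψn_diagPart_le hlam hhV hh hS.1 hS.2.1 U
  by_cases hUd : J.ψn U < ⊤
  · have hud := hle.trans_lt hUd
    have hUb : J.ψn U ≠ ⊥ := fun h => hψn.ne_bot u (le_bot_iff.1 (h ▸ hle))
    have hle' := EReal.toReal_le_toReal hle (hψn.ne_bot u) hUd.ne
    have hnorm := norm_sub_lift_sq hS.1 hS.2.1 U y
    rw [← hu] at hnorm
    have hgr := hψn.quadratic_growth hr.le hud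
    rw [hψn.proxObj_of_lt_top hzr, proxObj, ← EReal.coe_toReal hUd.ne hUb, ← EReal.coe_add,
      EReal.coe_lt_coe_iff, inner_lift, ← hu, hnorm]
    have h1 : 0 ≤ I.M / 2 * ‖u - zr‖ ^ 2 := by positivity
    have h2 : 0 ≤ I.M / 2 * ‖U - lift P Q u‖ ^ 2 := by positivity
    -- Strictness: a competitor other than the lift of zr has either a different diagonal part or a
    -- nonzero orthogonal remainder.
    have h3 : 0 < I.M / 2 * ‖u - zr‖ ^ 2 + I.M / 2 * ‖U - lift P Q u‖ ^ 2 := by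
      by_cases hzu : u = zr
      · have : U - lift P Q u ≠ 0 := by
          rw [hzu]
          exact sub_ne_zero.2 hU
        have : 0 < ‖U - lift P Q u‖ := norm_pos_iff.2 this
        positivity
      · have : 0 < ‖u - zr‖ := norm_pos_iff.2 (sub_ne_zero.2 hzu)
        positivity
    linarith
  · have h2 : proxObj J.ψn 0 (lift P Q g) (lift P Q y) I.M U = ⊤ := by
      rw [← not_lt_top_iff]
      exact fun h3 => hUd (proxObj_lt_top_iff.1 h3)
    rw [h2]
    exact proxObj_lt_top_iff.2 hzr

lemma matInput_Δ_lift (hlam : 0 < lam) (hf : AbsSymmetric f₂V)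
    (hhV : ProperLscConvex hV) (hh : AbsSymmetric hV) (hS : IsSVD P Q (shifted f₁ lam Z₀))
    {u y v : VecSpace m n} (hu : (vecInput M₂ f₁ f₂V hV lam θ Z₀ P Q).ψn u < ⊤)
    (hy : (vecInput M₂ f₁ f₂V hV lam θ Z₀ P Q).ψn y < ⊤) :
    (matInput M₂ f₁ f₂V hV lam θ Z₀).Δ (lift P Q u) (lift P Q y) (lift P Q v) =
      (vecInput M₂ f₁ f₂V hV lam θ Z₀ P Q).Δ u y v := by
  have hψn := vecInput_ψn_proper (M₂ := M₂) (f₁ := f₁) (f₂V := f₂V) (θ := θ) (Z₀ := Z₀) (P := P)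
    (Q := Q) hlam hhV
  have key : ∀ w, (vecInput M₂ f₁ f₂V hV lam θ Z₀ P Q).ψn w < ⊤ →
      ((matInput M₂ f₁ f₂V hV lam θ Z₀).ψ (lift P Q w)).toReal =
        ((vecInput M₂ f₁ f₂V hV lam θ Z₀ P Q).ψ w).toReal + offset f₁ lam Z₀ := by
    intro w hw
    rw [Input.ψ_eq (hψn.ne_bot w) hw, Input.ψ_eq, matInput_val_lift hf hh hS, EReal.toReal_coe,
      EReal.toReal_coe]
    · rw [matInput_ψn_lift hh hS.1 hS.2.1]
      exact hψn.ne_bot w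
    · rwa [matInput_ψn_lift hh hS.1 hS.2.1]
  rw [Input.Δ, Input.Δ, key u hu, key y hy, ← lift_sub, ← lift_sub, inner_lift_lift hS.1 hS.2.1,
    norm_lift hS.1 hS.2.1]
  have : (matInput M₂ f₁ f₂V hV lam θ Z₀).μ = (vecInput M₂ f₁ f₂V hV lam θ Z₀ P Q).μ := rfl
  rw [this]
  ring

lemma matInput_mem_dom_lift (hh : AbsSymmetric hV) (hS : IsSVD P Q (shifted f₁ lam Z₀))
    {y : VecSpace m n} (hy : (vecInput M₂ f₁ f₂V hV lam θ Z₀ P Q).ψn y < ⊤) :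
    (matInput M₂ f₁ f₂V hV lam θ Z₀).ψ (lift P Q y) < ⊤ := by
  rw [Input.ψ_lt_top_iff, matInput_ψn_lift hh hS.1 hS.2.1]
  exact hy

lemma matInput_bound_lift (hS : IsSVD P Q (shifted f₁ lam Z₀)) {y v : VecSpace m n} {ε : ℝ}
    (hb : ‖v‖ ^ 2 + 2 * ε ≤ (vecInput M₂ f₁ f₂V hV lam θ Z₀ P Q).θ ^ 2 *
      ‖y - (vecInput M₂ f₁ f₂V hV lam θ Z₀ P Q).x₀‖ ^ 2) :
    ‖lift P Q v‖ ^ 2 + 2 * ε ≤ (matInput M₂ f₁ f₂V hV lam θ Z₀).θ ^ 2 *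
      ‖lift P Q y - (matInput M₂ f₁ f₂V hV lam θ Z₀).x₀‖ ^ 2 := by
  rw [norm_lift hS.1 hS.2.1]
  exact hb.trans (mul_le_mul_of_nonneg_left (norm_sub_x₀_le hS.1 hS.2.1 y) (sq_nonneg _))

/-- A successful run on the vector problem lifts to a solution of the matrix Problem B. -/
theorem problemB_lift (hlam : 0 < lam) (hf₂V : Differentiable ℝ f₂V) (hf : AbsSymmetric f₂V)
    (hhV : ProperLscConvex hV) (hh : AbsSymmetric hV) (hS : IsSVD P Q (shifted f₁ lam Z₀))
    {y v : VecSpace m n} {ε : ℝ}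
    (hrun : RACG (vecInput M₂ f₁ f₂V hV lam θ Z₀ P Q) (.success y v ε)) :
    ProblemB (matInput M₂ f₁ f₂V hV lam θ Z₀) (lift P Q y) (lift P Q v) ε := by
  have hψn := vecInput_ψn_proper (M₂ := M₂) (f₁ := f₁) (f₂V := f₂V) (θ := θ) (Z₀ := Z₀) (P := P)
    (Q := Q) hlam hhV
  obtain ⟨s, t, zr, step, small, refined, check, rfl, rfl, rfl⟩ :=
    Input.Loop.exists_of_success hrun
  have hx := step.lt_top hψn
  have hzr : (vecInput M₂ f₁ f₂V hV lam θ Z₀ P Q).ψn zr < ⊤ := by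
    have := refined
    rw [Input.IsRefined, Input.refined_objective] at this
    exact hψn.lt_top_of_isMin this.le
  refine ⟨matInput_mem_dom_lift hh hS hx, le_max_left _ _, matInput_bound_lift hS small,
    lift P Q zr, isRefined_lift hlam hf₂V hf hhV hh hS refined, ?_⟩
  rw [matInput_Δ_lift hlam hf hhV hh hS hzr hx]
  exact check

/-- A solution of the vector Problem A lifts to a solution of the matrix Problem A. -/
theorem problemA_lift (hlam : 0 < lam) (hc : ConvexOn ℝ Set.univ f₂V) (hf : AbsSymmetric f₂V)
    (hhV : ProperLscConvex hV) (hh : AbsSymmetric hV) (hS : IsSVD P Q (shifted f₁ lam Z₀))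
    {y v : VecSpace m n} {ε : ℝ}
    (hA : ProblemA (vecInput M₂ f₁ f₂V hV lam θ Z₀ P Q) y v ε) :
    ProblemA (matInput M₂ f₁ f₂V hV lam θ Z₀) (lift P Q y) (lift P Q v) ε := by
  have hψn := vecInput_ψn_proper (M₂ := M₂) (f₁ := f₁) (f₂V := f₂V) (θ := θ) (Z₀ := Z₀) (P := P)
    (Q := Q) hlam hhV
  have hy := Input.ψ_lt_top_iff.1 hA.mem_dom
  refine ⟨matInput_mem_dom_lift hh hS hy, hA.eps_nonneg, fun U => ?_,
    matInput_bound_lift hS hA.bound⟩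
  have hle := vecInput_ψn_diagPart_le (M₂ := M₂) (f₁ := f₁) (f₂V := f₂V) (θ := θ) (Z₀ := Z₀)
    hlam hhV hh hS.1 hS.2.1 U
  have hsub := hA.subdiff (diagPart P Q U)
  have hvψ := fun w => Input.ψ_eq (I := vecInput M₂ f₁ f₂V hV lam θ Z₀ P Q) (hψn.ne_bot w)
  have hlψ : (matInput M₂ f₁ f₂V hV lam θ Z₀).ψ (lift P Q y) =
      ((matInput M₂ f₁ f₂V hV lam θ Z₀).val (lift P Q y) : EReal) := by
    apply Input.ψ_eq <;> rw [matInput_ψn_lift hh hS.1 hS.2.1]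
    · exact hψn.ne_bot y
    · exact hy
  by_cases hU : (matInput M₂ f₁ f₂V hV lam θ Z₀).ψn U < ⊤
  · have hud := hle.trans_lt hU
    have hUb : (matInput M₂ f₁ f₂V hV lam θ Z₀).ψn U ≠ ⊥ :=
      fun h => hψn.ne_bot _ (le_bot_iff.1 (h ▸ hle))
    have hle' := EReal.toReal_le_toReal hle (hψn.ne_bot _) hU.ne
    have hfle := mul_le_mul_of_nonneg_left (apply_diagPart_le_of_convexOn hc hf hS.1 hS.2.1 U)
      hlam.le
    simp only [hvψ _ hud, hvψ _ hy] at hsub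
    simp only [hlψ, Input.ψ_eq hUb hU, matInput_val_lift hf hh hS]
    norm_cast at hsub ⊢
    rw [sub_self, norm_zero] at hsub ⊢
    have hnorm := norm_sub_lift_sq hS.1 hS.2.1 U y
    -- The case w = 0 splits ‖U‖². The remainder adds ½‖·‖² in ψ and subtracts it in the μ-term;
    -- since μ = 1 these cancel exactly.
    have hnorm0 := norm_sub_lift_sq hS.1 hS.2.1 U 0
    have hl0 : lift P Q (0 : VecSpace m n) = 0 := by
      rw [← sub_self (0 : VecSpace m n), lift_sub, sub_self]
    rw [hl0, sub_zero, sub_zero] at hnorm0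
    rw [inner_sub_right, inner_lift, inner_lift_lift hS.1 hS.2.1, hnorm]
    rw [inner_sub_right] at hsub
    have hval : (matInput M₂ f₁ f₂V hV lam θ Z₀).val U =
        lam * f₂V (singVals U) - inner ℝ (singVals (shifted f₁ lam Z₀)) (diagPart P Q U)
          + 1 / 2 * ‖U‖ ^ 2 + offset f₁ lam Z₀
          + ((matInput M₂ f₁ f₂V hV lam θ Z₀).ψn U).toReal := by
      rw [Input.val, matInput_ψs, inner_shifted hS]
    have hvalv : (vecInput M₂ f₁ f₂V hV lam θ Z₀ P Q).val (diagPart P Q U) =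
        lam * f₂V (diagPart P Q U) - inner ℝ (singVals (shifted f₁ lam Z₀)) (diagPart P Q U)
          + 1 / 2 * ‖diagPart P Q U‖ ^ 2
          + ((vecInput M₂ f₁ f₂V hV lam θ Z₀ P Q).ψn (diagPart P Q U)).toReal := rfl
    have hμ : (matInput M₂ f₁ f₂V hV lam θ Z₀).μ = 1 := rfl
    have hμ' : (vecInput M₂ f₁ f₂V hV lam θ Z₀ P Q).μ = 1 := rfl
    rw [hμ, hval, hnorm0]
    rw [hμ', hvalv] at hsub
    linarith
  · have : (matInput M₂ f₁ f₂V hV lam θ Z₀).ψ U = ⊤ := by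
      rw [← not_lt_top_iff]
      exact fun h3 => hU (Input.ψ_lt_top_iff.1 h3)
    simp only [this, EReal.top_sub_coe, le_top]

/-- Under convexity and the quadratic upper bound, the vector data are regular. -/
lemma vecInput_regular (hM₂ : 0 < M₂) (hlam : 0 < lam) (hθ : 0 < θ)
    (hf₂V : Differentiable ℝ f₂V) (hc : ConvexOn ℝ Set.univ f₂V)
    (hup : ∀ u z, f₂V u - linApprox f₂V u z ≤ M₂ / 2 * ‖u - z‖ ^ 2)
    (hhV : ProperLscConvex hV) : (vecInput M₂ f₁ f₂V hV lam θ Z₀ P Q).Regular := by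
  -- The linear part of ψ_s drops out of its first-order remainder, leaving λ times that of f₂^V
  -- plus ½‖u - z‖²; hence μ = 1 and M = λM₂ + 1.
  have key : ∀ u z, (vecInput M₂ f₁ f₂V hV lam θ Z₀ P Q).ψs u =
      linApprox (vecInput M₂ f₁ f₂V hV lam θ Z₀ P Q).ψs u z
        + lam * (f₂V u - linApprox f₂V u z) + 1 / 2 * ‖u - z‖ ^ 2 := by
    intro u z
    rw [linApprox, linApprox, gradient_vecInput_ψs hf₂V]
    simp only [vecInput, inner_add_left, inner_sub_left, real_inner_smul_left, inner_sub_right,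
      norm_sub_sq_real, real_inner_self_eq_norm_sq, real_inner_comm u z]
    ring
  have hmax : (vecInput M₂ f₁ f₂V hV lam θ Z₀ P Q).M = lam * M₂ + 1 := by
    simp [vecInput, hM₂.le]
  have hμ : (vecInput M₂ f₁ f₂V hV lam θ Z₀ P Q).μ = 1 := rfl
  refine ⟨hμ ▸ zero_le_one, ?_, hθ, fun u z => ?_, fun u z => ?_, vecInput_ψn_proper hlam hhV⟩
  · rw [hmax, hμ]
    have := mul_pos hlam hM₂
    linarith
  · have h1 := mul_nonneg hlam.le (sub_nonneg.2 (linApprox_le_of_convexOn hc (hf₂V z) u))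
    have h2 := key u z
    rw [hμ]
    linarith
  · have h1 := mul_le_mul_of_nonneg_left (hup u z) hlam.le
    have h2 := key u z
    rw [hmax]
    linarith

end Subproblems

end SpectralACG

end

open SpectralACG in
theorem proposition4p1 (m n : ℕ)
    (f₁ : MatSpace m n → ℝ) (f₂V : VecSpace m n → ℝ) (hV : VecSpace m n → EReal)
    (M₂ lam θ : ℝ) (Z₀ : MatSpace m n)
    (hf₁ : ContDiff ℝ 1 f₁)
    (hf₂V : ContDiff ℝ 1 f₂V) (hf₂V_symm : AbsSymmetric f₂V)
    (hhV : ProperLscConvex hV) (hhV_symm : AbsSymmetric hV)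
    (hM₂ : 0 < M₂) (hlam : 0 < lam) (hθ : 0 < θ) :
    (∀ P Q Y V ε, SpectralRACG M₂ f₁ f₂V hV lam θ Z₀ P Q (.success Y V ε) →
      ProblemB (matInput M₂ f₁ f₂V hV lam θ Z₀) Y V ε) ∧
    (ConvexOn ℝ Set.univ (fun U : MatSpace m n => f₂V (singVals U)) →
      (∀ u z, f₂V u - linApprox f₂V u z ≤ M₂ / 2 * ‖u - z‖ ^ 2) →
      (∃ P Q, IsSVD P Q (shifted f₁ lam Z₀)) ∧
      ∀ P Q, IsSVD P Q (shifted f₁ lam Z₀) →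
        ∃ Y V ε,
          (∀ o, SpectralRACG M₂ f₁ f₂V hV lam θ Z₀ P Q o ↔ o = .success Y V ε) ∧
          ProblemA (matInput M₂ f₁ f₂V hV lam θ Z₀) Y V ε) := by
  have hd : Differentiable ℝ f₂V := hf₂V.differentiable one_ne_zero
  refine ⟨?_, fun hconv hup => ⟨exists_isSVD _, fun P Q hS => ?_⟩⟩
  · rintro P Q Y V ε ⟨hS, o, hrun, ho⟩
    cases o with
    | failure => cases ho
    | success y v ε' =>
      cases ho
      exact problemB_lift hlam hd hf₂V_symm hhV hhV_symm hS hrun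
  · have hc := convexOn_of_comp_singVals hf₂V_symm hconv
    obtain ⟨y, v, ε, huniq, hA⟩ := (vecInput_regular (f₁ := f₁) (Z₀ := Z₀) (P := P) (Q := Q)
      hM₂ hlam hθ hd hc hup hhV).racg
    refine ⟨lift P Q y, lift P Q v, ε, fun o => ⟨?_, ?_⟩,
      problemA_lift hlam hc hf₂V_symm hhV hhV_symm hS hA⟩
    · rintro ⟨-, o₁, hrun, ho⟩
      rw [ho, (huniq o₁).1 hrun]
      rfl
    · rintro rfl
      exact ⟨hS, _, (huniq _).2 rfl, rfl⟩
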